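/- Let $H$ be a (real or complex) Hilbert space and let $A:\mathscr D(A)\subset H\to H$ be a linear operator such that one of the following two conditions holds: - $A$ is a self-adjoint positive definite operator with compact resolvent; - $H$ is finite dimensional (and $\mathscr D(A)=H$). Let $\mathscr D(A^*)'$ be the dual of $\mathscr D(A^*)$ (with the graph norm) with respect to the pivot space $H$. Let $U$ be a Hilbert space and $B\in\mathscr L(U,\mathscr D(A^*)')$ (possibly unbounded as an operator into $H$). Let $n\ge 2$ be an integer, let $U_1,\dots,U_n$ be Hilbert spaces, let $\pi:U_1\times\cdots\times U_n\to U$ be an isomorphism (linear, bounded, with bounded inverse), and let $B_i\in\mathscr L(U_i,\mathscr D(A^*)')$ be defined by $B\pi(u_1,\dots,u_n)=\sum_{i=1}^n B_iu_i$ for all $(u_1,\dots,u_n)\in U_1\times\cdots\times U_n$. Solutions are understood by transposition: for $f\in L^2(0,T;\mathscr D(A^*)')$, the solution $y:[0,T]\to\mathscr D(A^*)'$ of $y'+Ay=f$, $y(0)=y_0\in H$, is defined by $$\langle y(\tau),z(\tau)\rangle=\langle y_0,z(0)\rangle_H+\int_0^\tau\langle f(t),z(t)\rangle\,dt$$ for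 all $\tau\in[0,T]$ and all $z\in C([0,\tau];\mathscr D(A^*))\cap C^1([0,\tau];H)$ with $-z'+A^*z=0$ on $[0,\tau]$. Assume that the system $y'+Ay=Bu$, $y(0)=y_0$, is null-controllable in arbitrary small times: for every $T>0$ there is $C_T$ such that for every $y_0\in H$ there is $u\in L^2(0,T;U)$ with $\|u\|_{L^2(0,T;U)}\le C_T\|y_0\|_H$ for which the solution satisfies $y(T)=0$. Then the system $$y'+Ay=\sum_{i=1}^nB_iu_i,\quad t\in(0,T),\qquad y(0)=y_0,$$ is null-controllable in arbitrary small times with switching controls: for every $T>0$ there is a constant $C_T'$ such that for every $y_0\in H$ there are controls $u_i\in L^2(0,T;U_i)$ with $\|u_i\|_{L^2(0,T;U_i)}\le C_T'\|y_0\|_H$, $i\in\{1,\dots,n\}$, for which the solution satisfies $y(T)=0$ and $$\prod_{i=1}^n\Big(\sum_{j\ne i}\|u_j(t)\|_{U_j}\Big)=0\quad\text{for a.e. }t\in(0,T),$$ that is, at almost every time at most one of the controls is nonzero. -/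

import Mathlib

open MeasureTheory Set
open scoped NNReal ENNReal

namespace SwitchingControl

section Operators

variable {𝕜 : Type*} [RCLike 𝕜] {H : Type*} [NormedAddCommGroup H] [InnerProductSpace 𝕜 H]

/-- `A` has compact resolvent: for some scalar `μ`, the operator `μ - A : 𝒟(A) → H` is bijective
and its inverse is a compact operator `R` on `H`. -/
def HasCompactResolvent (A : H →ₗ.[𝕜] H) : Prop :=
  ∃ (μ : 𝕜) (R : H →L[𝕜] H), IsCompactOperator R ∧
    (∀ x : H, ∃ h : R x ∈ A.domain, μ • R x - A ⟨R x, h⟩ = x) ∧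
    (∀ x : A.domain, R (μ • (x : H) - A x) = x)

/-- Positive definiteness of a (possibly unbounded) operator: `⟨A x, x⟩ > 0` for all
nonzero `x ∈ 𝒟(A)`. -/
def IsPosDef (A : H →ₗ.[𝕜] H) : Prop :=
  ∀ x : A.domain, x ≠ 0 → 0 < RCLike.re (inner 𝕜 (A x) (x : H))

variable [CompleteSpace H]

/-- The domain `𝒟(A*)` of the adjoint with its graph norm. It is realised as the graph of `A*`, a
subspace of `H × H`: a vector `φ ∈ 𝒟(A*)` is the pair `(φ, A* φ)`, and the norm
`max ‖φ‖ ‖A* φ‖` is equivalent to `(‖φ‖² + ‖A* φ‖²)^(1/2)`. -/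
abbrev AdjDomain (A : H →ₗ.[𝕜] H) : Type _ := A.adjoint.graph

/-- The dual space `𝒟(A*)'` with respect to the pivot space `H`: bounded antilinear functionals
on `𝒟(A*)`, where `y ∈ H` is identified with `φ ↦ ⟨y, φ⟩_H`, that is `φ ↦ inner 𝕜 φ y`
(`inner` being antilinear in its first argument). -/
abbrev AdjDual (A : H →ₗ.[𝕜] H) : Type _ := AdjDomain A →L⋆[𝕜] 𝕜

/-- `z` solves the adjoint equation `-z' + A* z = 0` on `[0, τ]` in the classical sense:
`z ∈ C([0, τ]; 𝒟(A*)) ∩ C¹([0, τ]; H)`. The time derivative is taken in `H` regarded as a real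
normed space. -/
def IsAdjointSolution (A : H →ₗ.[𝕜] H) (τ : ℝ) (z : ℝ → AdjDomain A) : Prop :=
  letI : NormedSpace ℝ H := NormedSpace.restrictScalars ℝ 𝕜 H
  ContinuousOn z (Icc 0 τ) ∧
    ∀ t ∈ Icc 0 τ, HasDerivWithinAt (fun s => (z s : H × H).1) (z t : H × H).2 (Icc 0 τ) t

/-- `y : [0, T] → 𝒟(A*)'` is the solution (by transposition) of `y' + A y = f` on `(0, T)`,
`y(0) = y₀ ∈ H`, with source term `f ∈ L²(0, T; 𝒟(A*)')`: for every `τ ∈ [0, T]` and every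
solution `z` of the adjoint equation on `[0, τ]`,
`⟨y(τ), z(τ)⟩ = ⟨y₀, z(0)⟩_H + ∫₀^τ ⟨f(t), z(t)⟩ dt`.
When `-A*` generates a `C⁰` semigroup, `z(τ)` ranges over all of `𝒟(A*)`, so that this determines
`y(τ)` for all `τ ∈ [0, T]`. -/
def IsSolution (A : H →ₗ.[𝕜] H) (T : ℝ) (y₀ : H) (f : ℝ → AdjDual A) (y : ℝ → AdjDual A) : Prop :=
  ∀ τ ∈ Icc 0 T, ∀ z : ℝ → AdjDomain A, IsAdjointSolution A τ z →
    y τ (z τ) = inner 𝕜 (z 0 : H × H).1 y₀ + ∫ t in (0 : ℝ)..τ, f t (z t)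

/-- The system `y' + A y = B u`, `y(0) = y₀`, with `B ∈ ℒ(U, 𝒟(A*)')`, is null-controllable in
arbitrary small times: for every `T > 0` there is `C` such that every `y₀ ∈ H` can be
steered to `y(T) = 0` by some `u ∈ L²(0, T; U)` with `‖u‖_{L²(0, T; U)} ≤ C ‖y₀‖_H`. -/
def IsNullControllable {U : Type*} [NormedAddCommGroup U] [InnerProductSpace 𝕜 U]
    (A : H →ₗ.[𝕜] H) (B : U →L[𝕜] AdjDual A) : Prop :=
  ∀ T : ℝ, 0 < T → ∃ C : ℝ≥0, ∀ y₀ : H, ∃ (u : ℝ → U) (y : ℝ → AdjDual A),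
    MemLp u 2 (volume.restrict (Ioo 0 T)) ∧
    IsSolution A T y₀ (fun t => B (u t)) y ∧ y T = 0 ∧
    eLpNorm u 2 (volume.restrict (Ioo 0 T)) ≤ C * ‖y₀‖ₑ

end Operators

section Switching

variable {n : ℕ} {V : Fin n → Type*} [∀ i, NormedAddCommGroup (V i)]

/-- The controls `u₁, …, uₙ` are switching on `(0, T)`:
`∏ i, (∑ j ≠ i, ‖uⱼ(t)‖) = 0` for a.e. `t ∈ (0, T)`. -/
def IsSwitching (T : ℝ) (u : ∀ i, ℝ → V i) : Prop :=
  ∀ᵐ t ∂(volume.restrict (Ioo 0 T)), ∏ i, ∑ j ∈ Finset.univ.erase i, ‖u j t‖ = 0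

variable {𝕜 : Type*} [RCLike 𝕜] [∀ i, InnerProductSpace 𝕜 (V i)]
  {H : Type*} [NormedAddCommGroup H] [InnerProductSpace 𝕜 H] [CompleteSpace H]

/-- The system `y' + A y = ∑ i, Bᵢ uᵢ`, `y(0) = y₀`, with `Bᵢ ∈ ℒ(Uᵢ, 𝒟(A*)')`, is
null-controllable in arbitrary small times with switching controls: for every `T > 0` there is
`C` such that every `y₀ ∈ H` can be steered to `y(T) = 0` by switching controls
`uᵢ ∈ L²(0, T; Uᵢ)` with `‖uᵢ‖_{L²(0, T; Uᵢ)} ≤ C ‖y₀‖_H` for each `i`. -/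
def IsNullControllableSwitching (A : H →ₗ.[𝕜] H) (B : ∀ i, V i →L[𝕜] AdjDual A) : Prop :=
  ∀ T : ℝ, 0 < T → ∃ C : ℝ≥0, ∀ y₀ : H, ∃ (u : ∀ i, ℝ → V i) (y : ℝ → AdjDual A),
    (∀ i, MemLp (u i) 2 (volume.restrict (Ioo 0 T))) ∧
    IsSolution A T y₀ (fun t => ∑ i, B i (u i t)) y ∧ y T = 0 ∧
    (∀ i, eLpNorm (u i) 2 (volume.restrict (Ioo 0 T)) ≤ C * ‖y₀‖ₑ) ∧
    IsSwitching T u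

end Switching

end SwitchingControl

namespace SwitchingControl

open Filter Topology

/-- A continuous, coercive, midpoint quasi-convex function on a Hilbert space attains its
infimum. -/
theorem exists_forall_le_of_midpoint_le_max {E : Type*} (𝕜 : Type*) [RCLike 𝕜]
    [NormedAddCommGroup E] [InnerProductSpace 𝕜 E] [CompleteSpace E] {J : E → ℝ}
    (hc : Continuous J) (hmid : ∀ p q, J ((2⁻¹ : 𝕜) • (p + q)) ≤ max (J p) (J q))
    (hbdd : BddBelow (range J)) {R : ℝ} (hR : ∀ p, J p ≤ J 0 → ‖p‖ ≤ R) :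
    ∃ p, ∀ q, J p ≤ J q := by
  set m := ⨅ p, J p with hm
  have hle : ∀ p, m ≤ J p := fun p => ciInf_le hbdd p
  by_cases h0 : J 0 = m
  · exact ⟨0, fun q => h0 ▸ hle q⟩
  have h0' : m < J 0 := lt_of_le_of_ne (hle 0) (Ne.symm h0)
  set ε : ℕ → ℝ := fun n => (J 0 - m) * (1 / ((n : ℝ) + 1)) with hε
  have hεpos : ∀ n, 0 < ε n := fun n => mul_pos (sub_pos.2 h0') Nat.one_div_pos_of_nat
  have hεlim : Tendsto ε atTop (𝓝 0) := by
    simpa [hε] using (tendsto_one_div_add_atTop_nhds_zero_nat (𝕜 := ℝ)).const_mul (J 0 - m)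
  have hεanti : Antitone ε := fun a b hab =>
    mul_le_mul_of_nonneg_left (Nat.one_div_le_one_div hab) (sub_pos.2 h0').le
  have hε0 : ∀ n, ε n ≤ J 0 - m := fun n => by simpa [hε] using hεanti (Nat.zero_le n)
  set s : ℕ → Set E := fun n => {p | J p ≤ m + ε n} with hs
  have hne : ∀ n, (s n).Nonempty := fun n => by
    obtain ⟨p, hp⟩ := exists_lt_of_ciInf_lt (show ⨅ p, J p < m + ε n by linarith [hεpos n])
    exact ⟨p, hp.le⟩
  have hsub : ∀ {a b}, a ≤ b → s b ⊆ s a := fun hab p hp => by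
    have := hεanti hab
    simp only [hs, mem_ofPred_eq] at hp ⊢
    linarith
  have hsR : ∀ n, ∀ p ∈ s n, ‖p‖ ≤ R := fun n p hp => hR p (by
    have := hε0 n
    simp only [hs, mem_ofPred_eq] at hp
    linarith)
  set d : ℕ → ℝ := fun n => sInf (norm '' s n) with hd
  have hbd : ∀ n, BddBelow (norm '' s n) := fun n =>
    ⟨0, by rintro _ ⟨p, -, rfl⟩; exact norm_nonneg _⟩
  have hdle : ∀ n, ∀ p ∈ s n, d n ≤ ‖p‖ := fun n p hp => csInf_le (hbd n) ⟨p, hp, rfl⟩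
  have hd0 : ∀ n, 0 ≤ d n := fun n =>
    le_csInf ((hne n).image _) (by rintro _ ⟨p, -, rfl⟩; exact norm_nonneg _)
  have hdmono : Monotone d := fun a b hab => csInf_le_csInf (hbd a) ((hne b).image _)
    (image_mono (hsub hab))
  have hdbdd : BddAbove (range d) := ⟨R, by
    rintro _ ⟨n, rfl⟩
    obtain ⟨p, hp⟩ := hne n
    exact (hdle n p hp).trans (hsR n p hp)⟩
  set D := ⨆ n, d n with hD
  have hdlim : Tendsto d atTop (𝓝 D) := tendsto_atTop_ciSup hdmono hdbdd
  have hex : ∀ n, ∃ p ∈ s n, ‖p‖ < d n + ε n := fun n => by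
    obtain ⟨_, ⟨p, hp, rfl⟩, h⟩ := exists_lt_of_csInf_lt ((hne n).image _)
      (show sInf (norm '' s n) < d n + ε n by linarith [hεpos n])
    exact ⟨p, hp, h⟩
  choose x hxs hxn using hex
  have hcau : CauchySeq x := by
    refine cauchySeq_of_le_tendsto_0'
      (fun n => √(2 * (d n + ε n) ^ 2 + 2 * (D + ε n) ^ 2 - 4 * d n ^ 2)) ?_ ?_
    · intro n k hnk
      refine Real.le_sqrt_of_sq_le ?_
      have hmem : (2⁻¹ : 𝕜) • (x n + x k) ∈ s n :=
        (hmid _ _).trans (max_le (hxs n) (hsub hnk (hxs k)))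
      have h1 := hdle n _ hmem
      rw [norm_smul, norm_inv, RCLike.norm_ofNat] at h1
      have h2 := parallelogram_law_with_norm 𝕜 (x n) (x k)
      have h3 : ‖x k‖ ≤ D + ε n :=
        (hxn k).le.trans (add_le_add (le_ciSup hdbdd k) (hεanti hnk))
      have h4 : ‖x n‖ ^ 2 ≤ (d n + ε n) ^ 2 := by gcongr; exact (hxn n).le
      have h5 : ‖x k‖ ^ 2 ≤ (D + ε n) ^ 2 := by gcongr
      have h6 : d n ^ 2 ≤ (2⁻¹ * ‖x n + x k‖) ^ 2 := by gcongr; exact hd0 n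
      rw [dist_eq_norm]
      nlinarith
    · have h : Tendsto (fun n => 2 * (d n + ε n) ^ 2 + 2 * (D + ε n) ^ 2 - 4 * d n ^ 2) atTop
          (𝓝 (2 * (D + 0) ^ 2 + 2 * (D + 0) ^ 2 - 4 * D ^ 2)) :=
        ((((hdlim.add hεlim).pow 2).const_mul 2).add
          (((tendsto_const_nhds.add hεlim).pow 2).const_mul 2)).sub ((hdlim.pow 2).const_mul 4)
      have h' := h.sqrt
      rwa [show 2 * (D + 0) ^ 2 + 2 * (D + 0) ^ 2 - 4 * D ^ 2 = 0 by ring, Real.sqrt_zero] at h'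
  obtain ⟨p, hp⟩ := cauchySeq_tendsto_of_complete hcau
  refine ⟨p, fun q => le_trans ?_ (hle q)⟩
  refine le_of_tendsto_of_tendsto' ((hc.tendsto p).comp hp)
    (by simpa using tendsto_const_nhds.add hεlim) (fun n => hxs n)

section L2

variable {α : Type*} {mα : MeasurableSpace α} {μ : Measure α}

theorem norm_sq_eq_integral_norm_sq {F : Type*} [NormedAddCommGroup F] (f : Lp F 2 μ) :
    ‖f‖ ^ 2 = ∫ t, ‖f t‖ ^ 2 ∂μ := by
  rw [Lp.norm_def, (Lp.memLp f).eLpNorm_eq_integral_rpow_norm two_ne_zero ENNReal.ofNat_ne_top]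
  have h : 0 ≤ ∫ t, ‖f t‖ ^ 2 ∂μ := integral_nonneg fun _ => sq_nonneg _
  simp only [ENNReal.toReal_ofNat, Real.rpow_two]
  rw [ENNReal.toReal_ofReal (by positivity), ← Real.rpow_natCast, ← Real.rpow_mul h]
  norm_num

theorem integrable_norm_sq_coeFn {F : Type*} [NormedAddCommGroup F] (f : Lp F 2 μ) :
    Integrable (fun t => ‖f t‖ ^ 2) μ := by
  simpa using (Lp.memLp f).integrable_norm_pow two_ne_zero

theorem integrable_norm_mul_norm_coeFn {F G : Type*} [NormedAddCommGroup F] [NormedAddCommGroup G]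
    (f : Lp F 2 μ) (g : Lp G 2 μ) :
    Integrable (fun t => ‖f t‖ * ‖g t‖) μ :=
  MemLp.integrable_mul (Lp.memLp f).norm (Lp.memLp g).norm

end L2

section DominantPart

variable {𝕜 : Type*} [RCLike 𝕜] {ι : Type*} [Fintype ι] {V : ι → Type*}
  [∀ i, NormedAddCommGroup (V i)] [∀ i, InnerProductSpace 𝕜 (V i)]

open scoped Classical in
/-- The only component of `e` whose norm strictly dominates the others, if there is one. -/
noncomputable def dominantPart (e : PiLp 2 V) : PiLp 2 V :=
  WithLp.toLp 2 fun i => if ∀ j, j ≠ i → ‖e j‖ < ‖e i‖ then e i else 0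

theorem dominantPart_zero : dominantPart (0 : PiLp 2 V) = 0 := by
  ext i
  simp only [dominantPart]
  split_ifs <;> rfl

theorem dominantPart_apply_of_lt {e : PiLp 2 V} {i : ι} (h : ∀ j, j ≠ i → ‖e j‖ < ‖e i‖) :
    dominantPart e i = e i := by
  simp only [dominantPart]
  rw [if_pos h]

theorem dominantPart_apply_of_ne {e : PiLp 2 V} {i : ι} (h : ∀ j, j ≠ i → ‖e j‖ < ‖e i‖)
    {j : ι} (hj : j ≠ i) : dominantPart e j = 0 := by
  simp only [dominantPart]
  rw [if_neg fun h' => lt_asymm (h j hj) (h' i hj.symm)]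

theorem exists_forall_ne_dominantPart_eq_zero [Nonempty ι] (e : PiLp 2 V) :
    ∃ i, ∀ j, j ≠ i → dominantPart e j = 0 := by
  by_cases h : ∃ i, ∀ j, j ≠ i → ‖e j‖ < ‖e i‖
  · obtain ⟨i, hi⟩ := h
    exact ⟨i, fun j hj => dominantPart_apply_of_ne hi hj⟩
  · push Not at h
    refine ⟨Classical.arbitrary ι, fun j _ => ?_⟩
    obtain ⟨k, hk, hk'⟩ := h j
    simp only [dominantPart]
    rw [if_neg fun h' => (h' k hk).not_ge hk']

theorem norm_dominantPart_le [Nonempty ι] (e : PiLp 2 V) :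
    ‖dominantPart e‖ ≤ ‖WithLp.ofLp e‖ := by
  obtain ⟨i, hi⟩ := exists_forall_ne_dominantPart_eq_zero e
  have h : ‖dominantPart e‖ = ‖dominantPart e i‖ := by
    rw [PiLp.norm_eq_of_L2, Finset.sum_eq_single i (fun j _ hj => by simp [hi j hj]) (by simp),
      Real.sqrt_sq (norm_nonneg _)]
  rw [h]
  refine le_trans ?_ (norm_le_pi_norm (WithLp.ofLp e) i)
  simp only [dominantPart]
  split_ifs <;> simp

theorem exists_forall_ne_norm_lt [Nonempty ι] {e : PiLp 2 V} (he : e ≠ 0)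
    (h : ∀ i j, i ≠ j → ‖e i‖ = ‖e j‖ → e i = 0) : ∃ i, ∀ j, j ≠ i → ‖e j‖ < ‖e i‖ := by
  obtain ⟨i, hi⟩ := Finite.exists_max fun i => ‖e i‖
  refine ⟨i, fun j hj => lt_of_le_of_ne (hi j) fun heq => he ?_⟩
  have h0 := h i j hj.symm heq.symm
  ext k
  have := hi k
  simpa [h0] using this

theorem hasDerivAt_norm_sq_add_smul {F : Type*} [NormedAddCommGroup F] [InnerProductSpace 𝕜 F]
    (a b : F) :
    HasDerivAt (fun s : ℝ => ‖a + (s : 𝕜) • b‖ ^ 2) (2 * RCLike.re (inner 𝕜 b a)) 0 := by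
  have h : (fun s : ℝ => ‖a + (s : 𝕜) • b‖ ^ 2) =
      fun s : ℝ => ‖a‖ ^ 2 + s * (2 * RCLike.re (inner 𝕜 b a)) + s ^ 2 * ‖b‖ ^ 2 := by
    funext s
    rw [norm_add_sq (𝕜 := 𝕜), inner_smul_right, RCLike.re_ofReal_mul, inner_re_symm, norm_smul,
      RCLike.norm_ofReal, mul_pow, sq_abs]
    ring
  rw [h]
  have h1 := ((hasDerivAt_id (0 : ℝ)).mul_const (2 * RCLike.re (inner 𝕜 b a))).const_add (‖a‖ ^ 2)
  have h2 := ((hasDerivAt_id (0 : ℝ)).pow 2).mul_const (‖b‖ ^ 2)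
  simpa using h1.fun_add h2

/-- The square of the sup norm is differentiable at each vector with no tie between its components,
and its gradient is given by the dominant component. -/
theorem hasDerivAt_sup_norm_sq [Nonempty ι] {e : PiLp 2 V}
    (h : ∀ i j, i ≠ j → ‖e i‖ = ‖e j‖ → e i = 0) (b : PiLp 2 V) :
    HasDerivAt (fun s : ℝ => ‖WithLp.ofLp (e + (s : 𝕜) • b)‖ ^ 2)
      (2 * RCLike.re (inner 𝕜 b (dominantPart e))) 0 := by
  by_cases he : e = 0
  · subst he
    have h2 := ((hasDerivAt_id (0 : ℝ)).pow 2).mul_const (‖WithLp.ofLp b‖ ^ 2)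
    simpa [dominantPart_zero, norm_smul, mul_pow] using h2
  · obtain ⟨i, hi⟩ := exists_forall_ne_norm_lt he h
    have hin : inner 𝕜 b (dominantPart e) = inner 𝕜 (b i) (e i) := by
      rw [PiLp.inner_apply, Finset.sum_eq_single i, dominantPart_apply_of_lt hi]
      · intro j _ hj
        rw [dominantPart_apply_of_ne hi hj, inner_zero_right]
      · simp
    rw [hin]
    refine (hasDerivAt_norm_sq_add_smul (𝕜 := 𝕜) (e i) (b i)).congr_of_eventuallyEq ?_
    have hev : ∀ᶠ s : ℝ in 𝓝 0, ∀ j, j ≠ i →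
        ‖e j + (s : 𝕜) • b j‖ < ‖e i + (s : 𝕜) • b i‖ := by
      refine eventually_all.2 fun j => ?_
      by_cases hj : j = i
      · exact Eventually.of_forall fun s hj' => absurd hj hj'
      have hc : ∀ k, Continuous fun s : ℝ => ‖e k + (s : 𝕜) • b k‖ := fun k => by
        have := RCLike.continuous_ofReal (K := 𝕜)
        fun_prop
      refine ((hc j).continuousAt.eventually_lt (hc i).continuousAt ?_).mono fun s hs _ => hs
      simpa using hi j hj
    filter_upwards [hev] with s hs
    congr 1
    refine le_antisymm ((pi_norm_le_iff_of_nonneg (norm_nonneg _)).2 fun j => ?_)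
      (norm_le_pi_norm (WithLp.ofLp (e + (s : 𝕜) • b)) i)
    by_cases hj : j = i
    · subst hj; rfl
    · exact (hs j hj).le

theorem stronglyMeasurable_dominantPart {α : Type*} [MeasurableSpace α] {p : α → PiLp 2 V}
    (hp : StronglyMeasurable p) : StronglyMeasurable fun t => dominantPart (p t) := by
  classical
  have hpi : ∀ i, StronglyMeasurable fun t => p t i := fun i =>
    (PiLp.continuous_apply 2 V i).comp_stronglyMeasurable hp
  have hset : ∀ i, MeasurableSet {t | ∀ j, j ≠ i → ‖p t j‖ < ‖p t i‖} := fun i => by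
    simp only [ofPred_forall]
    exact MeasurableSet.iInter fun j => MeasurableSet.iInter fun _ =>
      measurableSet_lt (hpi j).norm.measurable (hpi i).norm.measurable
  have heq : (fun t => dominantPart (p t)) = fun t => ∑ i, PiLp.single 2 i
      ({t | ∀ j, j ≠ i → ‖p t j‖ < ‖p t i‖}.indicator (fun t => p t i) t) := by
    funext t
    ext k
    rw [WithLp.ofLp_sum, Finset.sum_apply, Finset.sum_eq_single k]
    · simp [dominantPart, indicator_apply]
    · intro j _ hj
      simp [hj.symm]
    · simp
  rw [heq]
  refine Finset.stronglyMeasurable_fun_sum _ fun i _ => ?_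
  have hcont : Continuous fun v : V i => (PiLp.single 2 i v : PiLp 2 V) :=
    (PiLp.continuous_toLp 2 V).comp (continuous_single i)
  exact hcont.comp_stronglyMeasurable ((hpi i).indicator (hset i))

end DominantPart

section Switching

variable {𝕜 : Type*} [RCLike 𝕜] {ι : Type*} [Fintype ι] {V : ι → Type*}
  [∀ i, NormedAddCommGroup (V i)] [∀ i, InnerProductSpace 𝕜 (V i)]
  {α : Type*} {mα : MeasurableSpace α} {μ : Measure α}

theorem norm_ofLp_le (e : PiLp 2 V) : ‖WithLp.ofLp e‖ ≤ ‖e‖ :=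
  (pi_norm_le_iff_of_nonneg (norm_nonneg _)).2 fun i => PiLp.norm_apply_le e i

theorem abs_norm_sq_ofLp_sub_le (a b : PiLp 2 V) :
    |‖WithLp.ofLp a‖ ^ 2 - ‖WithLp.ofLp b‖ ^ 2| ≤ ‖a - b‖ * (‖a‖ + ‖b‖) := by
  rw [sq_sub_sq, abs_mul, mul_comm]
  refine mul_le_mul ?_ ?_ (abs_nonneg _) (norm_nonneg _)
  · exact (abs_norm_sub_norm_le _ _).trans (norm_ofLp_le (a - b))
  · rw [abs_of_nonneg (by positivity)]
    exact add_le_add (norm_ofLp_le a) (norm_ofLp_le b)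

theorem norm_le_sqrt_card_mul_norm_ofLp (e : PiLp 2 V) :
    ‖e‖ ≤ √(Fintype.card ι) * ‖WithLp.ofLp e‖ := by
  rw [PiLp.norm_eq_of_L2, ← Real.sqrt_sq (norm_nonneg (WithLp.ofLp e)),
    ← Real.sqrt_mul (Nat.cast_nonneg _)]
  refine Real.sqrt_le_sqrt ?_
  calc ∑ i, ‖e i‖ ^ 2 ≤ ∑ _i : ι, ‖WithLp.ofLp e‖ ^ 2 := by
        gcongr with i
        exact norm_le_pi_norm (WithLp.ofLp e) i
    _ = _ := by simp

theorem hasDerivAt_integral_sup_norm_sq [Nonempty ι] (p q : Lp (PiLp 2 V) 2 μ)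
    (hp : ∀ i j, i ≠ j → ∀ᵐ t ∂μ, ‖p t i‖ = ‖p t j‖ → p t i = 0) :
    HasDerivAt (fun s : ℝ => ∫ t, ‖WithLp.ofLp (p t + (s : 𝕜) • q t)‖ ^ 2 ∂μ)
      (∫ t, 2 * RCLike.re (inner 𝕜 (q t) (dominantPart (p t))) ∂μ) 0 := by
  have hpm := Lp.stronglyMeasurable p
  have hqm := Lp.stronglyMeasurable q
  have hcont : Continuous (WithLp.ofLp : PiLp 2 V → ∀ i, V i) := PiLp.continuous_ofLp 2 V
  have hmeas : ∀ s : ℝ, StronglyMeasurable fun t => ‖WithLp.ofLp (p t + (s : 𝕜) • q t)‖ ^ 2 :=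
    fun s => by
      have h : StronglyMeasurable fun t => p t + (s : 𝕜) • q t := 
        hpm.add ((continuous_const_smul (s : 𝕜)).comp_stronglyMeasurable hqm)
      have h' : StronglyMeasurable fun t => WithLp.ofLp (p t + (s : 𝕜) • q t) :=
        hcont.comp_stronglyMeasurable h
      exact h'.norm.pow 2
  have hmeas' : StronglyMeasurable
      fun t => 2 * RCLike.re (inner 𝕜 (q t) (dominantPart (p t))) := by
    have h : StronglyMeasurable fun t => inner 𝕜 (q t) (dominantPart (p t)) :=
      hqm.inner (stronglyMeasurable_dominantPart hpm)
    have h' : StronglyMeasurable fun t => RCLike.re (inner 𝕜 (q t) (dominantPart (p t))) :=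
      RCLike.continuous_re.comp_stronglyMeasurable h
    exact h'.const_mul 2
  refine (hasDerivAt_integral_of_dominated_loc_of_lip (𝕜 := ℝ) (s := Metric.ball 0 1)
    (bound := fun t => 2 * (‖p t‖ * ‖q t‖) + 2 * ‖q t‖ ^ 2)
    (Metric.ball_mem_nhds _ one_pos) (Eventually.of_forall fun s => ?_) ?_ ?_ ?_ ?_ ?_).2
  · exact (hmeas s).aestronglyMeasurable
  · refine (integrable_norm_sq_coeFn p).mono' (hmeas 0).aestronglyMeasurable
      (Eventually.of_forall fun t => ?_)
    simp only [RCLike.ofReal_zero, zero_smul, add_zero]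
    rw [Real.norm_of_nonneg (by positivity)]
    gcongr
    exact norm_ofLp_le _
  · exact hmeas'.aestronglyMeasurable
  · refine Eventually.of_forall fun t => LipschitzOnWith.of_dist_le_mul fun a ha b hb => ?_
    rw [mem_ball_zero_iff, Real.norm_eq_abs] at ha hb
    rw [Real.dist_eq, Real.dist_eq, Real.coe_nnabs,
      abs_of_nonneg (show 0 ≤ 2 * (‖p t‖ * ‖q t‖) + 2 * ‖q t‖ ^ 2 by positivity)]
    refine (abs_norm_sq_ofLp_sub_le _ _).trans ?_
    have h1 : ‖(p t + (a : 𝕜) • q t) - (p t + (b : 𝕜) • q t)‖ = |a - b| * ‖q t‖ := by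
      rw [add_sub_add_left_eq_sub, ← sub_smul, norm_smul, ← RCLike.ofReal_sub, RCLike.norm_ofReal]
    have h2 : ∀ s : ℝ, |s| < 1 → ‖p t + (s : 𝕜) • q t‖ ≤ ‖p t‖ + ‖q t‖ := fun s hs => by
      refine (norm_add_le _ _).trans ?_
      rw [norm_smul, RCLike.norm_ofReal]
      nlinarith [norm_nonneg (q t)]
    rw [h1]
    calc |a - b| * ‖q t‖ * (‖p t + (a : 𝕜) • q t‖ + ‖p t + (b : 𝕜) • q t‖)
        ≤ |a - b| * ‖q t‖ * ((‖p t‖ + ‖q t‖) + (‖p t‖ + ‖q t‖)) := by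
          gcongr
          · exact h2 a ha
          · exact h2 b hb
      _ = _ := by ring
  · exact ((integrable_norm_mul_norm_coeFn p q).const_mul 2).add
      ((integrable_norm_sq_coeFn q).const_mul 2)
  · have hall : ∀ᵐ t ∂μ, ∀ i j, i ≠ j → ‖p t i‖ = ‖p t j‖ → p t i = 0 := by
      refine ae_all_iff.2 fun i => ae_all_iff.2 fun j => ?_
      by_cases hij : i = j
      · exact Eventually.of_forall fun t h => absurd hij h
      · filter_upwards [hp i j hij] with t ht _ using ht
    filter_upwards [hall] with t ht
    exact hasDerivAt_sup_norm_sq ht (q t)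

/-- Let `X` be a closed subspace of `L²(μ; ⨁ Vᵢ)` such that two components of an element of `X`
have the same norm only where they vanish. Then every `u₀` coincides on `X` with some
`u` having at most one nonzero component at almost every point. -/
theorem exists_switching_of_no_ties [Nonempty ι] [∀ i, CompleteSpace (V i)]
    (X : Submodule 𝕜 (Lp (PiLp 2 V) 2 μ)) (hXc : IsClosed (X : Set (Lp (PiLp 2 V) 2 μ)))
    (hX : ∀ p ∈ X, ∀ i j, i ≠ j → ∀ᵐ t ∂μ, ‖p t i‖ = ‖p t j‖ → p t i = 0)
    (u₀ : Lp (PiLp 2 V) 2 μ) :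
    ∃ u : Lp (PiLp 2 V) 2 μ, (∀ q ∈ X, inner 𝕜 q u = inner 𝕜 q u₀) ∧
      ‖u‖ ≤ 2 * √(Fintype.card ι) * ‖u₀‖ ∧ ∀ᵐ t ∂μ, ∃ i, ∀ j, j ≠ i → u t j = 0 := by
  classical
  set L : Lp (PiLp 2 V) 2 μ →L[𝕜] Lp (∀ i, V i) 2 μ :=
    ContinuousLinearMap.compLpL 2 μ (PiLp.continuousLinearEquiv 2 𝕜 V : PiLp 2 V →L[𝕜] ∀ i, V i)
    with hL
  have hLp : ∀ p : Lp (PiLp 2 V) 2 μ, ∀ᵐ t ∂μ, L p t = WithLp.ofLp (p t) := fun p =>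
    ContinuousLinearMap.coeFn_compLpL _ p
  have hnL : ∀ p, ‖p‖ ≤ √(Fintype.card ι) * ‖L p‖ := fun p => by
    refine Lp.norm_le_mul_norm_of_ae_le_mul ?_
    filter_upwards [hLp p] with t ht
    rw [ht]
    exact norm_le_sqrt_card_mul_norm_ofLp _
  set N : ℝ := √(Fintype.card ι) with hN
  have hN0 : 0 ≤ N := Real.sqrt_nonneg _
  have : CompleteSpace X := hXc.completeSpace_coe
  set J : X → ℝ := fun p => ‖L p‖ ^ 2 / 2 - RCLike.re (inner 𝕜 (p : Lp (PiLp 2 V) 2 μ) u₀) with hJ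
  have hlin : ∀ p : X, RCLike.re (inner 𝕜 (p : Lp (PiLp 2 V) 2 μ) u₀) ≤ N * ‖L p‖ * ‖u₀‖ :=
    fun p => (re_inner_le_norm _ _).trans (by gcongr; exact hnL p)
  have hJ0 : J 0 = 0 := by simp [hJ]
  have hJle : ∀ p, J p ≤ J 0 → ‖L p‖ ≤ 2 * N * ‖u₀‖ := fun p hp => by
    rw [hJ0] at hp
    have h1 := hlin p
    simp only [hJ] at hp
    by_contra! h
    have h2 : 0 < ‖L p‖ := lt_of_le_of_lt (by positivity) h
    nlinarith
  obtain ⟨p, hp⟩ := exists_forall_le_of_midpoint_le_max 𝕜 (J := J) (R := N * (2 * N * ‖u₀‖))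
    (by fun_prop)
    (fun p q => by
      have h1 : ‖L ((2⁻¹ : 𝕜) • (p + q) : X)‖ ^ 2 ≤ (‖L p‖ ^ 2 + ‖L q‖ ^ 2) / 2 := by
        have h2 : ‖L ((2⁻¹ : 𝕜) • (p + q) : X)‖ ≤ (‖L p‖ + ‖L q‖) / 2 := by
          rw [Submodule.coe_smul, Submodule.coe_add, map_smul, map_add, norm_smul, norm_inv,
            RCLike.norm_ofNat]
          linarith [norm_add_le (L p) (L q)]
        have h3 := pow_le_pow_left₀ (norm_nonneg _) h2 2
        nlinarith [sq_nonneg (‖L p‖ - ‖L q‖)]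
      have h4 : RCLike.re (inner 𝕜 (((2⁻¹ : 𝕜) • (p + q) : X) : Lp (PiLp 2 V) 2 μ) u₀) =
          (RCLike.re (inner 𝕜 (p : Lp (PiLp 2 V) 2 μ) u₀) +
            RCLike.re (inner 𝕜 (q : Lp (PiLp 2 V) 2 μ) u₀)) / 2 := by
        rw [Submodule.coe_smul, Submodule.coe_add, inner_smul_left, inner_add_left,
          show (starRingEnd 𝕜) (2⁻¹ : 𝕜) = ((2⁻¹ : ℝ) : 𝕜) by simp [map_ofNat],
          RCLike.re_ofReal_mul, map_add]
        ring
      have h5 : J ((2⁻¹ : 𝕜) • (p + q)) ≤ (J p + J q) / 2 := by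
        simp only [hJ]
        rw [h4]
        linarith
      rcases le_total (J p) (J q) with h | h
      · rw [max_eq_right h]; linarith
      · rw [max_eq_left h]; linarith)
    ⟨-(N * ‖u₀‖) ^ 2 / 2, by
      rintro _ ⟨p, rfl⟩
      have := hlin p
      simp only [hJ]
      nlinarith [sq_nonneg (‖L p‖ - N * ‖u₀‖)]⟩
    (fun p hp => (hnL p).trans (by gcongr; exact hJle p hp))
  have hpX := hX p p.2
  set P : Lp (PiLp 2 V) 2 μ := p.1 with hP
  have hdom : ∀ᵐ t ∂μ, ‖dominantPart (P t)‖ ≤ 1 * ‖L P t‖ := by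
    filter_upwards [hLp P] with t ht
    rw [ht, one_mul]
    exact norm_dominantPart_le _
  have hu : MemLp (fun t => dominantPart (P t)) 2 μ :=
    (Lp.memLp (L P)).of_le_mul
      (stronglyMeasurable_dominantPart (Lp.stronglyMeasurable P)).aestronglyMeasurable hdom
  set u : Lp (PiLp 2 V) 2 μ := hu.toLp _
  have hut : ∀ᵐ t ∂μ, u t = dominantPart (P t) := hu.coeFn_toLp
  have hre : ∀ q ∈ X, RCLike.re (inner 𝕜 q u) = RCLike.re (inner 𝕜 q u₀) := fun q hq => by
    have hmin : IsLocalMin (fun s : ℝ => J (p + (s : 𝕜) • ⟨q, hq⟩)) 0 :=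
      Eventually.of_forall fun s => by simpa using hp _
    have hJs : ∀ s : ℝ, J (p + (s : 𝕜) • ⟨q, hq⟩) =
        (∫ t, ‖WithLp.ofLp (P t + (s : 𝕜) • q t)‖ ^ 2 ∂μ) / 2 -
          (RCLike.re (inner 𝕜 P u₀) + s * RCLike.re (inner 𝕜 q u₀)) := fun s => by
      simp only [hJ]
      congr 1
      · rw [norm_sq_eq_integral_norm_sq]
        congr 1
        refine integral_congr_ae ?_
        filter_upwards [hLp ((p + (s : 𝕜) • ⟨q, hq⟩ : X) : Lp (PiLp 2 V) 2 μ),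
          Lp.coeFn_add P ((s : 𝕜) • q), Lp.coeFn_smul (s : 𝕜) q] with t h1 h2 h3
        simp only [h1]
        rw [Submodule.coe_add, Submodule.coe_smul, h2, Pi.add_apply, h3, Pi.smul_apply]
      · rw [Submodule.coe_add, Submodule.coe_smul, inner_add_left, inner_smul_left, map_add,
          RCLike.conj_ofReal, RCLike.re_ofReal_mul]
    simp_rw [hJs] at hmin
    have hder := ((hasDerivAt_integral_sup_norm_sq (𝕜 := 𝕜) P q hpX).div_const 2).sub
      (((hasDerivAt_id (0 : ℝ)).mul_const (RCLike.re (inner 𝕜 q u₀))).const_add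
        (RCLike.re (inner 𝕜 P u₀)))
    have h0 := hmin.hasDerivAt_eq_zero hder
    have hint : ∫ t, 2 * RCLike.re (inner 𝕜 (q t) (dominantPart (P t))) ∂μ =
        2 * RCLike.re (inner 𝕜 q u) := by
      rw [integral_const_mul, L2.inner_def, ← integral_re (L2.integrable_inner q u)]
      congr 1
      refine integral_congr_ae ?_
      filter_upwards [hut] with t ht
      rw [ht]
    rw [hint] at h0
    linarith
  refine ⟨u, fun q hq => ?_, ?_, ?_⟩
  · rw [← sub_eq_zero, ← inner_sub_right]
    have h := hre (inner 𝕜 q (u - u₀) • q) (X.smul_mem _ hq)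
    rw [← sub_eq_zero, ← map_sub, ← inner_sub_right, inner_smul_left, RCLike.conj_mul,
      ← RCLike.ofReal_pow, RCLike.ofReal_re] at h
    simpa using h
  · have h1 : ‖u‖ ≤ 1 * ‖L P‖ := by
      refine Lp.norm_le_mul_norm_of_ae_le_mul ?_
      filter_upwards [hut, hdom] with t ht h
      rwa [ht]
    rw [one_mul] at h1
    exact h1.trans (hJle p (hp 0))
  · filter_upwards [hut] with t ht
    rw [ht]
    exact exists_forall_ne_dominantPart_eq_zero _

end Switching

/-- Two real-analytic functions multiplied by distinct weights of the form `1 + a √t` can only agree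
on a set of positive measure if they vanish. -/
theorem ae_eq_zero_of_sqrt_weight_mul_eq {f g : ℝ → ℝ} {b : ℝ} (hb : 0 < b)
    (hf : AnalyticOnNhd ℝ f (Iio b)) (hg : AnalyticOnNhd ℝ g (Iio b)) {a c : ℝ} (hac : a ≠ c) :
    ∀ᵐ t ∂volume.restrict (Ioo 0 b), (1 + a * √t) * f t = (1 + c * √t) * g t → f t = 0 := by
  set P : ℝ → ℝ := fun t => (f t - g t) ^ 2 - t * (c * g t - a * f t) ^ 2 with hP
  have hPa : AnalyticOnNhd ℝ P (Iio b) := fun t ht => by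
    have h1 := hf t ht
    have h2 := hg t ht
    fun_prop
  have hconn : IsConnected (Iio b) := isConnected_Iio
  have hsub : Ioo 0 b ⊆ Iio b := fun t ht => ht.2
  by_cases h0 : ∃ x ∈ Iio b, P x ≠ 0
  · obtain ⟨x, hx, hPx⟩ := h0
    have hcod := hPa.preimage_zero_mem_codiscreteWithin hPx hx hconn
    have hae := ae_restrict_le_codiscreteWithin (μ := volume) measurableSet_Iio hcod
    have hae' : ∀ᵐ t ∂volume.restrict (Ioo 0 b), P t ≠ 0 :=
      ae_restrict_of_ae_restrict_of_subset hsub hae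
    filter_upwards [hae', ae_restrict_mem measurableSet_Ioo] with t ht ht0 heq
    refine absurd ?_ ht
    have h1 : f t - g t = √t * (c * g t - a * f t) := by linarith
    simp only [hP]
    rw [h1, mul_pow, Real.sq_sqrt ht0.1.le, sub_self]
  · push Not at h0
    have hneg : ∀ t, t < 0 → f t = 0 := fun t ht => by
      have h1 := h0 t (ht.trans hb)
      simp only [hP] at h1
      have h2 : (f t - g t) ^ 2 = 0 := by
        nlinarith [sq_nonneg (f t - g t), sq_nonneg (c * g t - a * f t)]
      have h3 : (c * g t - a * f t) ^ 2 = 0 := by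
        rw [h2] at h1
        have : t * (c * g t - a * f t) ^ 2 = 0 := by linarith
        exact (mul_eq_zero.1 this).resolve_left ht.ne
      have h4 : f t = g t := by linarith [pow_eq_zero_iff two_ne_zero |>.1 h2]
      have h5 := pow_eq_zero_iff two_ne_zero |>.1 h3
      rw [← h4, ← sub_mul] at h5
      exact (mul_eq_zero.1 h5).resolve_left (sub_ne_zero.2 hac.symm)
    have hz : EqOn f 0 (Iio b) :=
      hf.eqOn_zero_of_preconnected_of_eventuallyEq_zero hconn.isPreconnected
        (show (-1 : ℝ) ∈ Iio b by simp only [mem_Iio]; linarith)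
        (by filter_upwards [Iio_mem_nhds (show (-1 : ℝ) < 0 by norm_num)] with t ht using hneg t ht)
    filter_upwards [ae_restrict_mem measurableSet_Ioo] with t ht _ using hz (hsub ht)

theorem analyticOnNhd_norm_sq {𝕜 F : Type*} [RCLike 𝕜] [NormedAddCommGroup F]
    [InnerProductSpace 𝕜 F] [NormedSpace ℝ F] [IsScalarTower ℝ 𝕜 F] {k : ℝ → F} {s : Set ℝ}
    (hk : AnalyticOnNhd ℝ k s) : AnalyticOnNhd ℝ (fun t => ‖k t‖ ^ 2) s := fun t ht => by
  have h : ContDiff ℝ ⊤ fun x : F => ‖x‖ ^ 2 := contDiff_norm_sq 𝕜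
  have h' := (h.contDiffAt (x := k t)).analyticAt
  exact h'.comp (hk t ht)

/-- Diagonalization of a compact symmetric operator `T`: the family `c μ` of the orthogonal
projections onto its eigenspaces is separating, and every bounded sequence of multipliers
defines a diagonal operator. -/
theorem exists_diagonalization {𝕜 : Type*} [RCLike 𝕜] {H : Type*} [NormedAddCommGroup H]
    [InnerProductSpace 𝕜 H] [CompleteSpace H] {T : H →L[𝕜] H} (hT : IsCompactOperator T)
    (hT' : (T : H →ₗ[𝕜] H).IsSymmetric) :
    ∃ c : 𝕜 → H →L[𝕜] H, (∀ x y, (∀ μ, c μ x = c μ y) → x = y) ∧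
      (∀ μ x, T (c μ x) = μ • c μ x) ∧ (∀ μ x, c μ (T x) = μ • c μ x) ∧
      ∀ (m : 𝕜 → ℝ) (C : ℝ), 0 ≤ C → (∀ μ, |m μ| ≤ C) →
        ∃ D : H →L[𝕜] H, ‖D‖ ≤ C ∧ ∀ μ x, c μ (D x) = (m μ : 𝕜) • c μ x := by
  classical
  set G : 𝕜 → Submodule 𝕜 H := fun μ => Module.End.eigenspace (T : H →ₗ[𝕜] H) μ with hG
  have hGc : ∀ μ, IsClosed (G μ : Set H) := fun μ => by
    have h : (G μ : Set H) = {x | T x = μ • x} := by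
      ext x
      simp [hG]
    rw [h]
    exact isClosed_eq T.continuous (continuous_const_smul μ)
  have : ∀ μ, CompleteSpace (G μ) := fun μ => (hGc μ).completeSpace_coe
  have hsum : IsHilbertSum 𝕜 (fun μ => G μ) fun μ => (G μ).subtypeₗᵢ := by
    refine IsHilbertSum.mkInternal (F := G) hT'.orthogonalFamily_eigenspaces ?_
    have h := ContinuousLinearMap.orthogonalComplement_iSup_eigenspaces_eq_bot hT hT'
    rw [Submodule.topologicalClosure_eq_top_iff.2 h]
  set e : H ≃ₗᵢ[𝕜] lp (fun μ => G μ) 2 := hsum.linearIsometryEquiv with he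
  set c : 𝕜 → H →L[𝕜] H := fun μ => (G μ).subtypeL ∘L (lp.evalCLM 𝕜 (fun μ => G μ) 2 μ) ∘L
    (e : H →L[𝕜] lp (fun μ => G μ) 2) with hc
  have hcx : ∀ μ x, c μ x = ((e x μ : G μ) : H) := fun μ x => rfl
  have hTe : ∀ μ (v : G μ), T v = μ • (v : H) := fun μ v => Module.End.mem_eigenspace_iff.1 v.2
  have hTc : ∀ μ x, T (c μ x) = μ • c μ x := fun μ x => hTe μ (e x μ)
  have hin : ∀ μ (v : G μ) x, inner 𝕜 v (e x μ) = inner 𝕜 (v : H) x := fun μ v x => by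
    have h1 : e v = lp.single 2 μ v :=
      (e.symm_apply_eq.1 (hsum.linearIsometryEquiv_symm_apply_single v)).symm
    have h2 : inner 𝕜 (e v) (e x) = inner 𝕜 v (e x μ) := by
      rw [h1]
      exact lp.inner_single_left (𝕜 := 𝕜) (G := fun μ => G μ) μ v (e x)
    rw [← h2, e.inner_map_map]
  refine ⟨c, fun x y h => e.injective ?_, hTc, fun μ x => ?_, fun m C hC hm => ?_⟩
  · ext μ
    exact h μ
  · have h : e (T x) μ = μ • e x μ := by
      refine ext_inner_left 𝕜 fun v => ?_
      have h2 : inner 𝕜 (v : H) (T x) = inner 𝕜 (T v) x := (hT' v x).symm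
      have h3 : inner 𝕜 (v : H) (T (c μ x)) = inner 𝕜 (T v) (c μ x) := (hT' v _).symm
      rw [hTc, hTe, inner_smul_right, inner_smul_left, hcx, ← Submodule.coe_inner, hin] at h3
      rw [hin, inner_smul_right, hin, h2, hTe, inner_smul_left, h3]
    rw [hcx, h, hcx]
    rfl
  · have hmb : ∀ μ, ‖((m μ : 𝕜) • ContinuousLinearMap.id 𝕜 (G μ))‖ ≤ C := fun μ => by
      refine ContinuousLinearMap.opNorm_le_bound _ hC fun x => ?_
      rw [_root_.smul_apply, norm_smul, RCLike.norm_ofReal,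
        ContinuousLinearMap.id_apply]
      gcongr
      exact hm μ
    set D' := lp.mapCLM 2 (fun μ => (m μ : 𝕜) • ContinuousLinearMap.id 𝕜 (G μ)) hC hmb
    refine ⟨(e.symm : lp (fun μ => G μ) 2 →L[𝕜] H) ∘L D' ∘L (e : H →L[𝕜] lp (fun μ => G μ) 2),
      ?_, fun μ x => ?_⟩
    · refine ContinuousLinearMap.opNorm_le_bound _ hC fun x => ?_
      have h1 : ‖e.symm (D' (e x))‖ = ‖D' (e x)‖ := e.symm.norm_map _
      refine h1.trans_le ((D'.le_opNorm _).trans ?_)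
      rw [e.norm_map]
      gcongr
      exact lp.norm_mapCLM_le 2 _ _ _
    · have h1 : e (e.symm (D' (e x))) = D' (e x) := e.apply_symm_apply _
      have h2 : c μ (e.symm (D' (e x))) = ((D' (e x) μ : G μ) : H) := by rw [hcx, h1]
      exact h2

theorem pow_mul_exp_neg_le {l s : ℝ} (hl : 0 ≤ l) (hs : 0 < s) (n : ℕ) :
    l ^ n * Real.exp (-(l * s)) / n.factorial ≤ (s⁻¹) ^ n := by
  have h := Real.pow_div_factorial_le_exp (l * s) (by positivity) n
  rw [Real.exp_neg, inv_pow, ← div_eq_mul_inv, div_div, div_le_iff₀ (by positivity),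
    inv_mul_eq_div, le_div_iff₀ (by positivity), ← mul_pow]
  rw [div_le_iff₀ (by positivity)] at h
  exact h

theorem abs_exp_neg_sub_exp_neg_le {a b : ℝ} (ha : 0 ≤ a) (hb : 0 ≤ b) :
    |Real.exp (-a) - Real.exp (-b)| ≤ |a - b| := by
  wlog hab : a ≤ b generalizing a b
  · rw [abs_sub_comm, abs_sub_comm a]
    exact this hb ha (le_of_not_ge hab)
  have h1 : Real.exp (-b) ≤ Real.exp (-a) := Real.exp_le_exp.2 (by linarith)
  rw [abs_of_nonneg (by linarith), abs_sub_comm, abs_of_nonneg (by linarith)]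
  have h2 : Real.exp (-b) = Real.exp (-a) * Real.exp (-(b - a)) := by
    rw [← Real.exp_add]; congr 1; ring
  have h3 := Real.add_one_le_exp (-(b - a))
  have h4 : Real.exp (-a) ≤ 1 := Real.exp_le_one_iff.2 (by linarith)
  have h5 := Real.exp_pos (-a)
  nlinarith

theorem hasFPowerSeriesAt_mkPiRing {F : Type*} [NormedAddCommGroup F] [NormedSpace ℝ F]
    {f : ℝ → F} {s₀ : ℝ} {a : ℕ → F}
    (h : ∀ᶠ z in 𝓝 (0 : ℝ), HasSum (fun n => z ^ n • a n) (f (s₀ + z))) :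
    HasFPowerSeriesAt f
      (fun n => ContinuousMultilinearMap.mkPiRing ℝ (Fin n) (a n) : FormalMultilinearSeries ℝ ℝ F)
      s₀ := by
  refine hasFPowerSeriesAt_iff.2 ?_
  filter_upwards [h] with z hz
  simpa [FormalMultilinearSeries.coeff] using hz

section Semigroup

variable {𝕜 : Type*} [RCLike 𝕜] {H : Type*} [NormedAddCommGroup H] [InnerProductSpace 𝕜 H]
  [CompleteSpace H] [NormedSpace ℝ H] [IsScalarTower ℝ 𝕜 H]

/-- For a compact positive contraction `T` with trivial kernel and dense range, `E s` is
the analytic semigroup `exp (-s (T⁻¹ - 1))` and `K s` is `exp (-s (T⁻¹ - 1)) T⁻¹`. -/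
theorem exists_analytic_semigroup {T : H →L[𝕜] H} (hT : IsCompactOperator T)
    (hT' : (T : H →ₗ[𝕜] H).IsSymmetric) (hinj : Function.Injective T) (hdense : DenseRange T)
    (hle : ∀ x, ‖T x‖ ≤ ‖x‖) (hpos : ∀ x, 0 ≤ RCLike.re (inner 𝕜 (T x) x)) :
    ∃ E K : ℝ → H →L[𝕜] H, (∀ x, E 0 x = x) ∧ (∀ s, 0 ≤ s → ‖E s‖ ≤ 1) ∧
      (∀ s, 0 ≤ s → ∀ x, E s (T x) = T (E s x)) ∧
      (∀ x, ContinuousOn (fun s => E s x) (Ici 0)) ∧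
      (∀ s r x, 0 < s → 0 ≤ r → E (s + r) x = K s (T (E r x))) ∧
      (∀ x, AnalyticOnNhd ℝ (fun s => K s x) (Ioi 0)) ∧
      ∀ x s, 0 ≤ s → HasDerivWithinAt (fun r => E r (T x)) (-(E s (x - T x))) (Ici 0) s := by
  classical
  obtain ⟨c, hsep, hTc, hcT, hD⟩ := exists_diagonalization hT hT'
  set good : 𝕜 → Prop := fun μ => 0 < RCLike.re μ ∧ RCLike.re μ ≤ 1 ∧ ((RCLike.re μ : ℝ) : 𝕜) = μ
   
  have hcgood : ∀ μ x, c μ x ≠ 0 → good μ := fun μ x hx => by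
    have h1 := hTc μ x
    set v := c μ x
    have hvn : 0 < ‖v‖ := norm_pos_iff.2 hx
    have hconj : (starRingEnd 𝕜) μ = μ := by
      have h2 : inner 𝕜 (T v) v = inner 𝕜 v (T v) := hT' v v
      rw [h1, inner_smul_left, inner_smul_right] at h2
      exact mul_right_cancel₀ (inner_self_ne_zero.2 hx) h2
    have hre : ((RCLike.re μ : ℝ) : 𝕜) = μ := RCLike.conj_eq_iff_re.1 hconj
    have hnn : 0 ≤ RCLike.re μ := by
      have h2 := hpos v
      rw [h1, ← hre, inner_smul_left, RCLike.conj_ofReal, RCLike.re_ofReal_mul,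
        inner_self_eq_norm_sq] at h2
      exact nonneg_of_mul_nonneg_left h2 (by positivity)
    refine ⟨lt_of_le_of_ne hnn fun h0 => hx ?_, ?_, hre⟩
    · rw [← h0, RCLike.ofReal_zero] at hre
      rw [← hre, zero_smul] at h1
      exact hinj (by rw [h1, map_zero])
    · have h2 := hle v
      rw [h1, norm_smul] at h2
      exact (RCLike.re_le_norm μ).trans (le_of_mul_le_mul_right (by rwa [one_mul]) hvn)
  set l : 𝕜 → ℝ := fun μ => if good μ then (RCLike.re μ)⁻¹ - 1 else 0 with hl
  have hl0 : ∀ μ, 0 ≤ l μ := fun μ => by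
    simp only [hl]
    split_ifs with h
    · exact sub_nonneg.2 ((one_le_inv₀ h.1).2 h.2.1)
    · rfl
  set m : 𝕜 → ℝ := fun μ => (1 + l μ)⁻¹ with hm
  have hm0 : ∀ μ, 0 < m μ := fun μ => inv_pos.2 (by linarith [hl0 μ])
  have hml : ∀ μ, m μ * l μ = 1 - m μ := fun μ => by
    have : 1 + l μ ≠ 0 := by linarith [hl0 μ]
    simp only [hm]
    field_simp
    ring
  have hcT' : ∀ μ x, c μ (T x) = (m μ : 𝕜) • c μ x := fun μ x => by
    by_cases h : c μ x = 0
    · rw [hcT, h, smul_zero, smul_zero]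
    · have hg := hcgood μ x h
      rw [hcT]
      congr 1
      simp only [hm, hl, if_pos hg]
      rw [add_sub_cancel, inv_inv, hg.2.2]
  have hE : ∀ s : ℝ, ∃ E : H →L[𝕜] H, 0 ≤ s → ‖E‖ ≤ 1 ∧
      ∀ μ x, c μ (E x) = ((Real.exp (-(l μ * s)) : ℝ) : 𝕜) • c μ x := fun s => by
    by_cases hs : 0 ≤ s
    · obtain ⟨E, h1, h2⟩ := hD (fun μ => Real.exp (-(l μ * s))) 1 zero_le_one fun μ => by
        rw [abs_of_pos (Real.exp_pos _), Real.exp_le_one_iff]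
        have := mul_nonneg (hl0 μ) hs
        linarith
      exact ⟨E, fun _ => ⟨h1, h2⟩⟩
    · exact ⟨0, fun h => absurd h hs⟩
  choose E hE using hE
  have hEc : ∀ s, 0 ≤ s → ∀ μ x, c μ (E s x) = ((Real.exp (-(l μ * s)) : ℝ) : 𝕜) • c μ x :=
    fun s hs => (hE s hs).2
  have hEn : ∀ s, 0 ≤ s → ‖E s‖ ≤ 1 := fun s hs => (hE s hs).1
  have hK : ∀ s : ℝ, ∃ K : H →L[𝕜] H, 0 < s →
      ∀ μ x, c μ (K x) = (((1 + l μ) * Real.exp (-(l μ * s)) : ℝ) : 𝕜) • c μ x := fun s => by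
    by_cases hs : 0 < s
    · obtain ⟨K, -, h2⟩ := hD (fun μ => (1 + l μ) * Real.exp (-(l μ * s))) (1 + s⁻¹)
        (by positivity) fun μ => by
          have h := hl0 μ
          rw [abs_of_nonneg (by positivity), add_mul, one_mul]
          refine add_le_add ?_ ?_
          · rw [Real.exp_le_one_iff]
            have := mul_nonneg h hs.le
            linarith
          · simpa using pow_mul_exp_neg_le h hs 1
      exact ⟨K, fun _ => h2⟩
    · exact ⟨0, fun h => absurd h hs⟩
  choose K hKc using hK
  have hET : ∀ s, 0 ≤ s → ∀ x, E s (T x) = T (E s x) := fun s hs x =>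
    hsep _ _ fun μ => by rw [hEc s hs, hcT', hcT', hEc s hs, smul_comm]
  have hpow : ∀ s₀, 0 < s₀ → ∀ x, ∃ a : ℕ → H,
      (∀ᶠ z in 𝓝 (0 : ℝ), HasSum (fun n => z ^ n • a n) (E (s₀ + z) x)) ∧
      ∀ μ, c μ (a 1) = ((-(l μ * Real.exp (-(l μ * s₀))) : ℝ) : 𝕜) • c μ x := fun s₀ hs₀ x => by
    have hex : ∀ n : ℕ, ∃ D : H →L[𝕜] H, ‖D‖ ≤ (s₀⁻¹) ^ n ∧ ∀ μ x, c μ (D x) =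
        (((-l μ) ^ n * Real.exp (-(l μ * s₀)) / n.factorial : ℝ) : 𝕜) • c μ x := fun n =>
      hD _ _ (by positivity) fun μ => by
        rw [abs_div, abs_mul, abs_pow, abs_neg, abs_of_nonneg (hl0 μ), abs_of_pos (Real.exp_pos _),
          Nat.abs_cast]
        exact pow_mul_exp_neg_le (hl0 μ) hs₀ n
    choose D hDn hDc using hex
    refine ⟨fun n => D n x, ?_, fun μ => by rw [hDc]; congr 2; simp⟩
    filter_upwards [Metric.ball_mem_nhds (0 : ℝ) hs₀] with z hz
    rw [mem_ball_zero_iff, Real.norm_eq_abs] at hz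
    have hsum : Summable fun n => z ^ n • D n x := by
      refine Summable.of_norm_bounded (g := fun n => (|z| * s₀⁻¹) ^ n * ‖x‖)
        ((summable_geometric_of_lt_one (by positivity) ?_).mul_right _) fun n => ?_
      · rwa [← div_eq_mul_inv, div_lt_one hs₀]
      · rw [norm_smul, norm_pow, Real.norm_eq_abs, mul_pow, mul_assoc]
        gcongr
        exact (D n).le_of_opNorm_le (hDn n) x
    have hz' : 0 ≤ s₀ + z := by linarith [(abs_lt.1 hz).1]
    have heq : ∑' n, z ^ n • D n x = E (s₀ + z) x := hsep _ _ fun μ => by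
      have h1 := (hsum.hasSum.mapL (c μ))
      refine h1.unique ?_
      rw [hEc _ hz']
      have h2 : HasSum (fun n : ℕ => (-(l μ * z)) ^ n / n.factorial) (Real.exp (-(l μ * z))) := by
        have := NormedSpace.expSeries_div_hasSum_exp (-(l μ * z))
        rwa [← Real.exp_eq_exp_ℝ] at this
      have h3 := ((h2.mul_right (Real.exp (-(l μ * s₀)))).mapL (RCLike.ofRealCLM (K := 𝕜)))
        |>.smul_const (c μ x)
      convert h3 using 1
      · funext n
        rw [RCLike.real_smul_eq_coe_smul (K := 𝕜), map_smul, hDc, smul_smul]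
        simp only [RCLike.ofRealCLM_apply]
        rw [← RCLike.ofReal_mul]
        congr 2
        rw [show -(l μ * z) = -l μ * z by ring, mul_pow]
        ring
      · simp only [RCLike.ofRealCLM_apply]
        rw [← Real.exp_add]
        congr 3
        ring
    rw [← heq]
    exact hsum.hasSum
  have hderiv : ∀ x s, 0 < s → HasDerivAt (fun r => E r (T x)) (-(E s (x - T x))) s :=
    fun x s hs => by
      obtain ⟨a, ha, ha1⟩ := hpow s hs (T x)
      have h := (hasFPowerSeriesAt_mkPiRing (f := fun r => E r (T x)) ha).hasDerivAt
      convert h using 1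
      simp only [ContinuousMultilinearMap.mkPiRing_apply, Finset.prod_const_one, one_smul]
      refine hsep _ _ fun μ => ?_
      rw [ha1, map_neg, hEc s hs.le, map_sub, hcT', smul_smul, ← one_smul 𝕜 (c μ x), smul_smul,
        smul_smul, ← sub_smul, smul_smul, ← neg_smul]
      congr 1
      rw [mul_one, mul_one, ← RCLike.ofReal_one, ← RCLike.ofReal_sub, ← RCLike.ofReal_mul,
        ← RCLike.ofReal_neg, ← RCLike.ofReal_mul, ← hml μ]
      congr 1
      ring
  have hcont : ∀ x, ContinuousOn (fun s => E s x) (Ici 0) := by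
    have hTcont : ∀ y, ContinuousOn (fun s => E s (T y)) (Ici 0) := fun y => by
      refine LipschitzOnWith.continuousOn (K := ‖y‖.toNNReal)
        (LipschitzOnWith.of_dist_le_mul fun s hs r hr => ?_)
      obtain ⟨D, hDn, hDc⟩ := hD
        (fun μ => m μ * (Real.exp (-(l μ * s)) - Real.exp (-(l μ * r)))) |s - r| (abs_nonneg _)
        fun μ => by
          rw [abs_mul, abs_of_pos (hm0 μ)]
          have h1 := abs_exp_neg_sub_exp_neg_le (mul_nonneg (hl0 μ) hs) (mul_nonneg (hl0 μ) hr)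
          rw [← mul_sub, abs_mul, abs_of_nonneg (hl0 μ)] at h1
          calc m μ * |Real.exp (-(l μ * s)) - Real.exp (-(l μ * r))|
              ≤ m μ * (l μ * |s - r|) := by gcongr; exact (hm0 μ).le
            _ = (1 - m μ) * |s - r| := by rw [← mul_assoc, hml]
            _ ≤ 1 * |s - r| := by gcongr; linarith [hm0 μ]
            _ = |s - r| := one_mul _
      have heq : E s (T y) - E r (T y) = D y := hsep _ _ fun μ => by
        rw [map_sub, hEc s hs, hEc r hr, hDc, hcT', smul_smul, smul_smul, ← sub_smul]
        congr 1
        push_cast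
        ring
      rw [dist_eq_norm, heq, Real.dist_eq, Real.coe_toNNReal _ (norm_nonneg _), mul_comm]
      exact D.le_of_opNorm_le hDn y
    intro x
    refine continuousOn_of_uniform_approx_of_continuousOn fun u hu => ?_
    obtain ⟨ε, hε, hεu⟩ := Metric.mem_uniformity_dist.1 hu
    obtain ⟨y, hy⟩ := hdense.exists_dist_lt x hε
    refine ⟨fun s => E s (T y), hTcont y, fun s hs => hεu ?_⟩
    rw [dist_eq_norm, ← map_sub]
    refine lt_of_le_of_lt ((E s).le_of_opNorm_le (hEn s hs) _) ?_
    rwa [one_mul, ← dist_eq_norm]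
  refine ⟨E, K, fun x => hsep _ _ fun μ => ?_, hEn, hET, hcont, fun s r x hs hr => ?_,
    fun x s hs => ?_,
    fun x s hs => ?_⟩
  · rw [hEc 0 le_rfl]
    simp
  · refine hsep _ _ fun μ => ?_
    rw [hEc _ (by positivity), hKc s hs, hcT', hEc r hr, smul_smul, smul_smul]
    congr 1
    rw [← RCLike.ofReal_mul, ← RCLike.ofReal_mul]
    congr 1
    have h1 : 1 + l μ ≠ 0 := by linarith [hl0 μ]
    rw [mul_add, neg_add, Real.exp_add]
    simp only [hm]
    field_simp
  · rw [mem_Ioi] at hs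
    obtain ⟨a, ha, -⟩ := hpow (s / 2) (half_pos hs) x
    have h1 : AnalyticAt ℝ (fun r => E r x) (s / 2) := 
      (hasFPowerSeriesAt_mkPiRing (f := fun r => E r x) ha).analyticAt
    have h2 : AnalyticAt ℝ (fun r => E (r - s / 2) x) s :=
      AnalyticAt.fun_comp (f := fun r : ℝ => r - s / 2) (by rwa [sub_half]) (by fun_prop)
    have h3 : AnalyticAt ℝ (fun r => (K (s / 2)).restrictScalars ℝ (E (r - s / 2) x)) s :=
      (((K (s / 2)).restrictScalars ℝ).analyticAt _).comp h2
    refine h3.congr ?_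
    filter_upwards [Ioi_mem_nhds (show s / 2 < s by linarith)] with r hr
    rw [mem_Ioi] at hr
    refine hsep _ _ fun μ => ?_
    change c μ (K (s / 2) (E (r - s / 2) x)) = _
    rw [hKc _ (half_pos hs), hEc _ (by linarith), hKc r (by linarith), smul_smul,
      ← RCLike.ofReal_mul]
    congr 2
    rw [mul_assoc, ← Real.exp_add]
    congr 2
    ring
  · rcases hs.eq_or_lt with rfl | hs
    · refine hasDerivWithinAt_Ici_of_tendsto_deriv (s := Ioi 0)
        (fun r hr => (hderiv x r hr).differentiableAt.differentiableWithinAt)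
        ((hcont (T x) 0 self_mem_Ici).mono Ioi_subset_Ici_self) self_mem_nhdsWithin ?_
      have h1 : Tendsto (fun s => -(E s (x - T x))) (𝓝[>] 0) (𝓝 (-(E 0 (x - T x)))) :=
        ((hcont (x - T x) 0 self_mem_Ici).mono Ioi_subset_Ici_self).tendsto.neg
      refine h1.congr' ?_
      filter_upwards [self_mem_nhdsWithin] with r hr
      exact (hderiv x r hr).deriv.symm
    · exact (hderiv x s hs).hasDerivWithinAt

end Semigroup

section Flow

variable {𝕜 : Type*} [RCLike 𝕜] {H : Type*} [NormedAddCommGroup H] [InnerProductSpace 𝕜 H]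

/-- Energy estimate: `w' = v` with `-c ‖w‖² ≤ Re ⟨v, w⟩` has only the zero solution vanishing
at the final time. -/
theorem eq_zero_of_energy [NormedSpace ℝ H] [IsScalarTower ℝ 𝕜 H] {w v : ℝ → H} {τ c : ℝ}
    (hw : ∀ t ∈ Icc 0 τ, HasDerivWithinAt w (v t) (Icc 0 τ) t) (hτ : w τ = 0)
    (hc : ∀ t ∈ Icc 0 τ, -c * ‖w t‖ ^ 2 ≤ RCLike.re (inner 𝕜 (v t) (w t))) :
    ∀ t ∈ Icc 0 τ, w t = 0 := by
  intro t ht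
  have hτ0 : 0 ≤ τ := ht.1.trans ht.2
  have hder : ∀ t ∈ Icc 0 τ, HasDerivWithinAt (fun s => Real.exp (2 * c * s) * ‖w s‖ ^ 2)
      (Real.exp (2 * c * t) * (2 * c) * ‖w t‖ ^ 2 +
        Real.exp (2 * c * t) * (2 * RCLike.re (inner 𝕜 (v t) (w t)))) (Icc 0 τ) t := fun t ht => by
    have h1 := (hw t ht).inner 𝕜 (hw t ht)
    have h2 := ((RCLike.reCLM (K := 𝕜)).hasFDerivAt.comp_hasDerivWithinAt t h1)
    have h3 : HasDerivWithinAt (fun s => ‖w s‖ ^ 2) (2 * RCLike.re (inner 𝕜 (v t) (w t)))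
        (Icc 0 τ) t := by
      refine (h2.congr_deriv ?_).congr (fun s _ => ?_) ?_
      · rw [RCLike.reCLM_apply, map_add, inner_re_symm (w t)]
        ring
      all_goals exact (inner_self_eq_norm_sq (𝕜 := 𝕜) _).symm
    have h4 : HasDerivWithinAt (fun s => Real.exp (2 * c * s)) (Real.exp (2 * c * t) * (2 * c))
        (Icc 0 τ) t := by
      simpa using ((hasDerivAt_id t).const_mul (2 * c)).exp.hasDerivWithinAt
    exact h4.mul h3
  have hmono : MonotoneOn (fun s => Real.exp (2 * c * s) * ‖w s‖ ^ 2) (Icc 0 τ) := by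
    refine monotoneOn_of_hasDerivWithinAt_nonneg (convex_Icc 0 τ)
      (fun t ht => (hder t ht).continuousWithinAt)
      (fun t ht => (hder t (interior_subset ht)).mono interior_subset) fun t ht => ?_
    have h1 := hc t (interior_subset ht)
    have h2 := Real.exp_pos (2 * c * t)
    nlinarith
  have h1 := hmono ht (right_mem_Icc.2 hτ0) ht.2
  simp only [hτ, norm_zero] at h1
  have h2 : Real.exp (2 * c * t) * ‖w t‖ ^ 2 ≤ 0 := by simpa using h1
  have h3 : ‖w t‖ ^ 2 ≤ 0 := nonpos_of_mul_nonpos_right h2 (Real.exp_pos _)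
  exact norm_eq_zero.1 (pow_eq_zero_iff two_ne_zero |>.1 (le_antisymm h3 (sq_nonneg _)))

variable [CompleteSpace H]

/-- The backward flow of the adjoint equation `-z' + A* z = 0`: `S s φ` is the value of the
solution at distance `s` from the final time, where it equals `φ`. The solution is analytic away
from the final time, as expressed by the operators `K s` and the parametrization `Γ`. -/
structure AdjointFlow (A : H →ₗ.[𝕜] H) where
  /-- The flow on `𝒟(A*)`. -/
  S : ℝ → AdjDomain A →L[𝕜] AdjDomain A
  /-- A parametrization of `𝒟(A*)`. -/
  Γ : H →L[𝕜] AdjDomain A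
  /-- The flow for positive times, extended to `H` and read through the parametrization `Γ`. -/
  K : ℝ → H →L[𝕜] H
  S_zero : ∀ φ, S 0 φ = φ
  exists_bound : ∀ T, ∃ M, ∀ s ∈ Icc 0 T, ‖S s‖ ≤ M
  continuousOn : ∀ φ, ContinuousOn (fun s => S s φ) (Ici 0)
  S_add : ∀ s r φ, 0 < s → 0 ≤ r → S (s + r) φ = Γ (K s (S r φ : H × H).1)
  analytic : let _ : NormedSpace ℝ H := NormedSpace.restrictScalars ℝ 𝕜 H
    ∀ x, AnalyticOnNhd ℝ (fun s => K s x) (Ioi 0)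
  isAdjointSolution : ∀ τ φ, IsAdjointSolution A τ fun t => S (τ - t) φ
  eq_of_isAdjointSolution : ∀ τ z, IsAdjointSolution A τ z → ∀ t ∈ Icc 0 τ, z t = S (τ - t) (z τ)

theorem nonempty_adjointFlow_of_semigroup {A : H →ₗ.[𝕜] H} (e : H ≃L[𝕜] AdjDomain A)
    (E K : ℝ → H →L[𝕜] H) {c : ℝ} (hE0 : ∀ x, E 0 x = x)
    (hEb : ∀ T, ∃ M, ∀ s ∈ Icc 0 T, ‖E s‖ ≤ M)
    (hEc : ∀ x, ContinuousOn (fun s => E s x) (Ici 0))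
    (hEK : ∀ s r x, 0 < s → 0 ≤ r → E (s + r) x = K s (e (E r x) : H × H).1)
    (hK : let _ : NormedSpace ℝ H := NormedSpace.restrictScalars ℝ 𝕜 H
      ∀ x, AnalyticOnNhd ℝ (fun s => K s x) (Ioi 0))
    (hder : let _ : NormedSpace ℝ H := NormedSpace.restrictScalars ℝ 𝕜 H
      ∀ x s, 0 ≤ s → HasDerivWithinAt (fun r => (e (E r x) : H × H).1)
        (-(e (E s x) : H × H).2) (Ici 0) s)
    (hc : ∀ φ : AdjDomain A,
      -c * ‖(φ : H × H).1‖ ^ 2 ≤ RCLike.re (inner 𝕜 (φ : H × H).2 (φ : H × H).1)) :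
    Nonempty (AdjointFlow A) := by
  let _ : NormedSpace ℝ H := NormedSpace.restrictScalars ℝ 𝕜 H
  set S : ℝ → AdjDomain A →L[𝕜] AdjDomain A := fun s =>
    (e : H →L[𝕜] AdjDomain A) ∘L E s ∘L (e.symm : AdjDomain A →L[𝕜] H) with hS
  have hSφ : ∀ s φ, S s φ = e (E s (e.symm φ)) := fun s φ => rfl
  have hcont : ∀ φ, ContinuousOn (fun s => S s φ) (Ici 0) := fun φ =>
    e.continuous.comp_continuousOn (hEc _)
  have hsol : ∀ τ φ, IsAdjointSolution A τ fun t => S (τ - t) φ := fun τ φ => by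
    have hmaps : MapsTo (fun t => τ - t) (Icc 0 τ) (Ici 0) := fun t ht => sub_nonneg.2 ht.2
    refine ⟨(hcont φ).comp (by fun_prop) hmaps, fun t ht => ?_⟩
    have h1 := hder (e.symm φ) (τ - t) (hmaps ht)
    have h2 : HasDerivWithinAt (fun t => τ - t) (-1) (Icc 0 τ) t := by
      simpa using ((hasDerivAt_id t).const_sub τ).hasDerivWithinAt
    have h3 := h1.scomp t h2 hmaps
    simpa [Function.comp_def, hSφ] using h3
  refine ⟨⟨S, e, K, fun φ => ?_, fun T => ?_, hcont, fun s r φ hs hr => ?_, hK, hsol,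
    fun τ z hz t ht => ?_⟩⟩
  · rw [hSφ, hE0, e.apply_symm_apply]
  · obtain ⟨M, hM⟩ := hEb T
    refine ⟨‖(e : H →L[𝕜] AdjDomain A)‖ * (M * ‖(e.symm : AdjDomain A →L[𝕜] H)‖), fun s hs => ?_⟩
    refine (ContinuousLinearMap.opNorm_comp_le _ _).trans ?_
    gcongr
    refine (ContinuousLinearMap.opNorm_comp_le _ _).trans ?_
    gcongr
    exact hM s hs
  · rw [hSφ, hEK _ _ _ hs hr]
    rfl
  · set φ := z τ with hφ
    have hz' := hsol τ φ
    have hfst : ∀ t ∈ Icc 0 τ, ((z t - S (τ - t) φ : AdjDomain A) : H × H).1 = 0 := by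
      refine eq_zero_of_energy (𝕜 := 𝕜) (c := c)
        (v := fun t => ((z t - S (τ - t) φ : AdjDomain A) : H × H).2) (fun t ht => ?_) ?_
        fun t _ => hc _
      · exact (hz.2 t ht).sub (hz'.2 t ht)
      · simp [hSφ, hE0, hφ]
    have h0 : z t - S (τ - t) φ = 0 := by
      refine Subtype.ext (Prod.ext (hfst t ht) ?_)
      exact A.adjoint.graph_fst_eq_zero_snd (z t - S (τ - t) φ).2 (hfst t ht)
    exact sub_eq_zero.1 h0

/-- A self-adjoint positive operator is `T⁻¹ - 1` for some positive contraction `T`, here given as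
the first component of an isomorphism onto the graph. -/
theorem exists_resolvent_equiv {A : H →ₗ.[𝕜] H} (hA : IsSelfAdjoint A)
    (hpos : ∀ φ ∈ A.graph, 0 ≤ RCLike.re (inner 𝕜 φ.2 φ.1)) :
    ∃ e : H ≃L[𝕜] AdjDomain A, ∀ x, (e x : H × H).1 + (e x : H × H).2 = x := by
  have hAA : A.adjoint = A := LinearPMap.isSelfAdjoint_def.1 hA
  have hd := hA.dense_domain
  have hcl : IsClosed (A.adjoint.graph : Set (H × H)) := by
    rw [hAA]
    exact hA.isClosed
  have : CompleteSpace A.adjoint.graph := hcl.completeSpace_coe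
  set F : AdjDomain A →L[𝕜] H :=
    (ContinuousLinearMap.fst 𝕜 H H + ContinuousLinearMap.snd 𝕜 H H) ∘L A.adjoint.graph.subtypeL
    with hF
  have hFφ : ∀ φ : AdjDomain A, F φ = (φ : H × H).1 + (φ : H × H).2 := fun φ => rfl
  have hanti : ∀ φ : AdjDomain A, ‖φ‖ ≤ ‖F φ‖ := fun φ => by
    have h1 : 0 ≤ RCLike.re (inner 𝕜 (φ : H × H).2 (φ : H × H).1) :=
      hpos φ (LinearPMap.le_graph_of_le hAA.le φ.2)
    have h2 := norm_add_sq (𝕜 := 𝕜) (φ : H × H).1 (φ : H × H).2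
    rw [← hFφ, inner_re_symm] at h2
    have h3 : ‖φ‖ = max ‖(φ : H × H).1‖ ‖(φ : H × H).2‖ := rfl
    rw [h3]
    refine max_le (abs_le_of_sq_le_sq' ?_ (norm_nonneg _)).2
      (abs_le_of_sq_le_sq' ?_ (norm_nonneg _)).2
    · nlinarith [sq_nonneg ‖(φ : H × H).2‖]
    · nlinarith [sq_nonneg ‖(φ : H × H).1‖]
  have hanti' : AntilipschitzWith 1 F := AddMonoidHomClass.antilipschitz_of_bound F (K := 1)
    fun φ => by simpa using hanti φ
  have hrcl : IsClosed (range F) := hanti'.isClosed_range F.uniformContinuous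
  have hker : LinearMap.ker (F : AdjDomain A →ₗ[𝕜] H) = ⊥ := LinearMap.ker_eq_bot.2 hanti'.injective
  have hran : LinearMap.range (F : AdjDomain A →ₗ[𝕜] H) = ⊤ := by
    have : CompleteSpace (LinearMap.range (F : AdjDomain A →ₗ[𝕜] H)) :=
      IsComplete.completeSpace_coe (s := (LinearMap.range (F : AdjDomain A →ₗ[𝕜] H) : Set H))
        hrcl.isComplete
    rw [← Submodule.orthogonal_eq_bot_iff, Submodule.eq_bot_iff]
    intro y hy
    have hy' : ∀ φ ∈ A.graph, inner 𝕜 (φ.1 + φ.2) y = 0 := fun φ hφ => by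
      rw [← hAA] at hφ
      exact hy (F ⟨φ, hφ⟩) ⟨⟨φ, hφ⟩, rfl⟩
    have hmem : (y, -y) ∈ A.graph := by
      rw [← hAA, LinearPMap.adjoint_graph_eq_graph_adjoint hd, Submodule.mem_adjoint_iff]
      intro a b hab
      have := hy' (a, b) hab
      rw [inner_add_left] at this
      rw [inner_neg_right, sub_neg_eq_add, add_comm]
      exact this
    have h1 := hpos _ hmem
    simp only [inner_neg_left, map_neg, inner_self_eq_norm_sq] at h1
    exact norm_eq_zero.1
      (pow_eq_zero_iff two_ne_zero |>.1 (le_antisymm (by linarith) (sq_nonneg _)))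
  set e := ContinuousLinearEquiv.ofBijective F hker hran with he
  exact ⟨e.symm, fun x => e.apply_symm_apply x⟩

theorem nonempty_adjointFlow_of_isSelfAdjoint {A : H →ₗ.[𝕜] H} (hA : IsSelfAdjoint A)
    (hpos : IsPosDef A) (hcomp : HasCompactResolvent A) : Nonempty (AdjointFlow A) := by
  let _ : NormedSpace ℝ H := NormedSpace.restrictScalars ℝ 𝕜 H
  have hAA : A.adjoint = A := LinearPMap.isSelfAdjoint_def.1 hA
  have hd := hA.dense_domain
  have hpos' : ∀ φ ∈ A.graph, 0 ≤ RCLike.re (inner 𝕜 φ.2 φ.1) := fun φ hφ => by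
    obtain ⟨x, hx1, hx2⟩ := (LinearPMap.mem_graph_iff A).1 hφ
    rw [← hx1, ← hx2]
    by_cases hx : x = 0
    · simp [hx]
    · exact (hpos x hx).le
  obtain ⟨e, he⟩ := exists_resolvent_equiv hA hpos'
  have hmem : ∀ φ : AdjDomain A, (φ : H × H) ∈ A.graph := fun φ =>
    LinearPMap.le_graph_of_le hAA.le φ.2
  set T : H →L[𝕜] H := ContinuousLinearMap.fst 𝕜 H H ∘L A.adjoint.graph.subtypeL ∘L
    (e : H →L[𝕜] AdjDomain A)
  have hT : ∀ x, T x = (e x : H × H).1 := fun x => rfl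
  have he2 : ∀ x, (e x : H × H).2 = x - T x := fun x => eq_sub_of_add_eq' (he x)
  have hfa := LinearPMap.adjoint_isFormalAdjoint hd
  have hsymg : ∀ φ ψ : H × H, φ ∈ A.graph → ψ ∈ A.graph →
      inner 𝕜 φ.2 ψ.1 = inner 𝕜 φ.1 ψ.2 := fun φ ψ hφ hψ => by
    rw [← hAA] at hφ
    obtain ⟨x, hx1, hx2⟩ := (LinearPMap.mem_graph_iff _).1 hφ
    obtain ⟨y, hy1, hy2⟩ := (LinearPMap.mem_graph_iff _).1 hψ
    rw [← hx1, ← hx2, ← hy1, ← hy2]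
    exact hfa x y
  have hTc : IsCompactOperator T := by
    obtain ⟨μ, R, hR, -, hR2⟩ := hcomp
    have hTR : T = R ∘L ((μ + 1) • T - ContinuousLinearMap.id 𝕜 H) := by
      ext x
      obtain ⟨y, hy1, hy2⟩ := (LinearPMap.mem_graph_iff A).1 (hmem (e x))
      have h := hR2 y
      rw [hy1, hy2, he2, ← hT] at h
      rw [ContinuousLinearMap.comp_apply]
      refine h.symm.trans (congrArg R ?_)
      change μ • T x - (x - T x) = (μ + 1) • T x - x
      rw [add_smul, one_smul]
      abel
    rw [hTR]
    exact hR.comp_clm _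
  have hTs : (T : H →ₗ[𝕜] H).IsSymmetric := fun x y => by
    have h := hsymg _ _ (hmem (e x)) (hmem (e y))
    rw [he2, he2, ← hT, ← hT, inner_sub_left, inner_sub_right] at h
    exact (sub_left_injective h).symm
  have hTinj : Function.Injective T := by
    refine (injective_iff_map_eq_zero T).2 fun x hx => ?_
    have h1 := A.graph_fst_eq_zero_snd (hmem (e x)) hx
    rw [he2, hx, sub_zero] at h1
    exact h1
  have hTd : DenseRange T := by
    refine hd.mono fun x hx => ?_
    have hxg : (x, A ⟨x, hx⟩) ∈ A.adjoint.graph := by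
      rw [hAA]
      exact A.mem_graph ⟨x, hx⟩
    refine ⟨e.symm ⟨_, hxg⟩, ?_⟩
    rw [hT, e.apply_symm_apply]
  have hTpos : ∀ x, 0 ≤ RCLike.re (inner 𝕜 (x - T x) (T x)) := fun x => by
    have h := hpos' _ (hmem (e x))
    rwa [he2, ← hT] at h
  have hTpos' : ∀ x, ‖T x‖ ^ 2 ≤ RCLike.re (inner 𝕜 (T x) x) := fun x => by
    have h := hTpos x
    rw [inner_sub_left, map_sub, inner_self_eq_norm_sq, inner_re_symm] at h
    linarith
  have hTle : ∀ x, ‖T x‖ ≤ ‖x‖ := fun x => by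
    have h := (hTpos' x).trans (re_inner_le_norm _ _)
    rcases (norm_nonneg (T x)).eq_or_lt with h0 | h0
    · rw [← h0]
      exact norm_nonneg x
    · rw [sq] at h
      exact le_of_mul_le_mul_left h h0
  obtain ⟨E, K, hE0, hEn, hET, hEc, hEK, hK, hder⟩ := exists_analytic_semigroup hTc hTs hTinj hTd
    hTle fun x => (sq_nonneg _).trans (hTpos' x)
  refine nonempty_adjointFlow_of_semigroup (c := 0) e E K hE0 (fun T => ⟨1, fun s hs => hEn s hs.1⟩)
    hEc hEK hK (fun x s hs => ?_) fun φ => ?_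
  · have h1 := hder x s hs
    refine (h1.congr (fun r hr => (hET r hr x).symm) (hET s hs x).symm).congr_deriv ?_
    rw [he2, map_sub, hET s hs]
  · simpa using hpos' _ (hmem φ)

theorem nonempty_adjointFlow_of_finiteDimensional [FiniteDimensional 𝕜 H] {A : H →ₗ.[𝕜] H}
    (hA : A.domain = ⊤) : Nonempty (AdjointFlow A) := by
  let _ : NormedSpace ℝ H := NormedSpace.restrictScalars ℝ 𝕜 H
  obtain ⟨M, hM⟩ : ∃ M : H →L[𝕜] H, ∀ φ, φ ∈ A.adjoint.graph ↔ φ.2 = M φ.1 := by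
    set L : H →L[𝕜] H := LinearMap.toContinuousLinearMap
      (A.toFun ∘ₗ (LinearEquiv.ofTop A.domain hA).symm.toLinearMap) with hL
    have hAL : A = (L : H →ₗ[𝕜] H).toPMap ⊤ := by
      refine LinearPMap.ext hA fun x hx hx' => ?_
      rfl
    refine ⟨L.adjoint, fun φ => ?_⟩
    rw [hAL, ContinuousLinearMap.toPMap_adjoint_eq_adjoint_toPMap_of_dense _ (by simp),
      LinearPMap.mem_graph_iff]
    constructor
    · rintro ⟨y, hy1, hy2⟩
      rw [← hy1, ← hy2]
      rfl
    · intro h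
      exact ⟨⟨φ.1, trivial⟩, rfl, h.symm⟩
  set e : H ≃L[𝕜] AdjDomain A := ContinuousLinearEquiv.equivOfInverse
    (((ContinuousLinearMap.id 𝕜 H).prod M).codRestrict A.adjoint.graph fun x => (hM _).2 rfl)
    (ContinuousLinearMap.fst 𝕜 H H ∘L A.adjoint.graph.subtypeL) (fun x => rfl)
    (fun φ => Subtype.ext (Prod.ext rfl ((hM _).1 φ.2).symm)) with he
  have he2 : ∀ x, (e x : H × H).2 = M x := fun x => rfl
  let _ : NormedAlgebra ℚ (H →L[𝕜] H) := NormedAlgebra.restrictScalars ℚ 𝕜 (H →L[𝕜] H)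
  set E : ℝ → H →L[𝕜] H := fun s => NormedSpace.exp ((s : 𝕜) • -M) with hE
  have hadd : ∀ s r, E (s + r) = E s * E r := fun s r => by
    simp only [hE]
    rw [RCLike.ofReal_add, add_smul, NormedSpace.exp_add_of_commute]
    exact ((Commute.refl (-M)).smul_left _).smul_right _
  have hser : ∀ x s, HasFPowerSeriesAt (fun r => E r x)
      (fun n => ContinuousMultilinearMap.mkPiRing ℝ (Fin n)
        (((n.factorial⁻¹ : 𝕜) • (-M) ^ n) (E s x)) : FormalMultilinearSeries ℝ ℝ H) s :=
    fun x s => hasFPowerSeriesAt_mkPiRing <| Eventually.of_forall fun z => by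
      have h := NormedSpace.exp_series_hasSum_exp' (𝕂 := 𝕜) ((z : 𝕜) • -M)
      have h1 := h.mapL (ContinuousLinearMap.apply 𝕜 H (E s x))
      convert h1 using 1
      · funext n
        rw [RCLike.real_smul_eq_coe_smul (K := 𝕜), smul_pow, smul_comm, RCLike.ofReal_pow]
        simp
      · rw [add_comm, hadd]
        rfl
  have hEx : ∀ x s, HasDerivAt (fun s => E s x) (-(M (E s x))) s := fun x s => by
    simpa using (hser x s).hasDerivAt
  refine nonempty_adjointFlow_of_semigroup (c := ‖M‖) e E E (fun x => ?_) (fun T => ?_)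
    (fun x s _ => (hEx x s).continuousAt.continuousWithinAt) (fun s r x _ _ => ?_) (fun x s _ => ?_)
    (fun x s _ => ?_) fun φ => ?_
  · simp [hE]
  · have h : Continuous fun s : ℝ => (s : 𝕜) • -M :=
      RCLike.continuous_ofReal.fun_smul continuous_const
    have hc : Continuous E := NormedSpace.exp_continuous.comp h
    exact isCompact_Icc.exists_bound_of_continuousOn hc.continuousOn
  · rw [hadd]
    rfl
  · exact (hser x s).analyticAt
  · exact (hEx x s).hasDerivWithinAt
  · rw [(hM _).1 φ.2]
    have h := (RCLike.abs_re_le_norm _).trans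
      (norm_inner_le_norm (𝕜 := 𝕜) (M (φ : H × H).1) (φ : H × H).1)
    have h1 := M.le_opNorm (φ : H × H).1
    have h2 := (abs_le.1 h).1
    nlinarith [norm_nonneg (φ : H × H).1]

end Flow

section Observation

variable {𝕜 : Type*} [RCLike 𝕜]

/-- The adjoint of a control operator. -/
theorem exists_control_adjoint {D W : Type*} [NormedAddCommGroup D] [NormedSpace 𝕜 D]
    [NormedAddCommGroup W] [InnerProductSpace 𝕜 W] [CompleteSpace W]
    (b : W →L[𝕜] D →L⋆[𝕜] 𝕜) : ∃ L : D →L[𝕜] W, ∀ φ v, inner 𝕜 (L φ) v = b v φ := by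
  refine ⟨((InnerProductSpace.toDual 𝕜 W).symm.toContinuousLinearEquiv :
    StrongDual 𝕜 W →L⋆[𝕜] W).comp b.flip, fun φ v => ?_⟩
  exact InnerProductSpace.toDual_symm_apply

/-- A bounded, pointwise measurable family of operators defines an operator into `L²`. -/
theorem exists_clm_Lp {α D E : Type*} [MeasurableSpace α] {μ : Measure α} [IsFiniteMeasure μ]
    [NormedAddCommGroup D] [NormedSpace 𝕜 D] [NormedAddCommGroup E] [NormedSpace 𝕜 E]
    (k : α → D →L[𝕜] E) (hk : ∀ φ, AEStronglyMeasurable (fun t => k t φ) μ) {M : ℝ}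
    (hM : ∀ᵐ t ∂μ, ‖k t‖ ≤ M) :
    ∃ Ψ : D →L[𝕜] Lp E 2 μ, ∀ φ, ∀ᵐ t ∂μ, Ψ φ t = k t φ := by
  have hb : ∀ φ, ∀ᵐ t ∂μ, ‖k t φ‖ ≤ M * ‖φ‖ := fun φ => by
    filter_upwards [hM] with t ht using (k t).le_of_opNorm_le ht φ
  have hmem : ∀ φ, MemLp (fun t => k t φ) 2 μ := fun φ => MemLp.of_bound (hk φ) _ (hb φ)
  set L : D →ₗ[𝕜] Lp E 2 μ :=
    { toFun φ := (hmem φ).toLp _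
      map_add' φ ψ := by
        rw [← MemLp.toLp_add]
        exact MemLp.toLp_congr _ _ (Eventually.of_forall fun t => map_add (k t) φ ψ)
      map_smul' c φ := by
        rw [RingHom.id_apply, ← MemLp.toLp_const_smul]
        exact MemLp.toLp_congr _ _ (Eventually.of_forall fun t => map_smul (k t) c φ) } with hL
  refine ⟨L.mkContinuous ((measureUnivNNReal μ : ℝ) ^ (2⁻¹ : ℝ) * M) fun φ => ?_,
    fun φ => (hmem φ).coeFn_toLp⟩
  rw [mul_assoc]
  by_cases h0 : μ = 0
  · subst h0
    have : ‖L φ‖ = 0 := by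
      rw [Lp.norm_def]
      simp
    rw [this]
    simp
  · have : (ae μ).NeBot := ae_neBot.2 h0
    have hM0 : 0 ≤ M := by
      obtain ⟨t, ht⟩ := hM.exists
      exact (norm_nonneg _).trans ht
    have h := Lp.norm_le_of_ae_bound (f := L φ) (C := M * ‖φ‖) (by positivity) (by
      filter_upwards [hb φ, (hmem φ).coeFn_toLp] with t h1 h2
      change ‖(hmem φ).toLp _ t‖ ≤ _
      rwa [h2])
    rwa [ENNReal.toReal_ofNat] at h

end Observation

section Weight

variable {𝕜 : Type*} [RCLike 𝕜] {ι : Type*} {V : ι → Type*}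
  [∀ i, NormedAddCommGroup (V i)] [∀ i, InnerProductSpace 𝕜 (V i)]

variable (𝕜 V) in
/-- Multiplication of the components of a vector by real weights. -/
noncomputable def weightL (ρ : ι → ℝ) : PiLp 2 V →L[𝕜] PiLp 2 V :=
  ((PiLp.continuousLinearEquiv 2 𝕜 V).symm : (∀ i, V i) →L[𝕜] PiLp 2 V) ∘L
    ContinuousLinearMap.pi fun i => (ρ i : 𝕜) • PiLp.proj 2 V i

theorem weightL_apply (ρ : ι → ℝ) (e : PiLp 2 V) (i : ι) :
    weightL 𝕜 V ρ e i = (ρ i : 𝕜) • e i := rfl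

theorem weightL_weightL_inv {ρ : ι → ℝ} (hρ : ∀ i, ρ i ≠ 0) (e : PiLp 2 V) :
    weightL 𝕜 V ρ (weightL 𝕜 V (fun i => (ρ i)⁻¹) e) = e := by
  ext i
  rw [weightL_apply, weightL_apply, smul_smul, ← RCLike.ofReal_mul, mul_inv_cancel₀ (hρ i),
    RCLike.ofReal_one, one_smul]

variable [Fintype ι]

theorem norm_weightL_apply_le {ρ : ι → ℝ} {C : ℝ} (hC : 0 ≤ C) (hρ : ∀ i, |ρ i| ≤ C)
    (e : PiLp 2 V) : ‖weightL 𝕜 V ρ e‖ ≤ C * ‖e‖ := by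
  rw [PiLp.norm_eq_of_L2, PiLp.norm_eq_of_L2, ← Real.sqrt_sq hC, ← Real.sqrt_mul (sq_nonneg C),
    Finset.mul_sum]
  refine Real.sqrt_le_sqrt (Finset.sum_le_sum fun i _ => ?_)
  rw [weightL_apply, norm_smul, RCLike.norm_ofReal, mul_pow]
  gcongr
  exact hρ i

theorem norm_le_norm_weightL_apply {ρ : ι → ℝ} (hρ : ∀ i, 1 ≤ ρ i) (e : PiLp 2 V) :
    ‖e‖ ≤ ‖weightL 𝕜 V ρ e‖ := by
  rw [PiLp.norm_eq_of_L2, PiLp.norm_eq_of_L2]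
  refine Real.sqrt_le_sqrt (Finset.sum_le_sum fun i _ => ?_)
  rw [weightL_apply, norm_smul, RCLike.norm_ofReal]
  gcongr
  exact le_mul_of_one_le_left (norm_nonneg _) ((hρ i).trans (le_abs_self _))

theorem inner_weightL_left (ρ : ι → ℝ) (e f : PiLp 2 V) :
    inner 𝕜 (weightL 𝕜 V ρ e) f = inner 𝕜 e (weightL 𝕜 V ρ f) := by
  rw [PiLp.inner_apply, PiLp.inner_apply]
  refine Finset.sum_congr rfl fun i _ => ?_
  rw [weightL_apply, weightL_apply, inner_smul_left, inner_smul_right, RCLike.conj_ofReal]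

theorem aestronglyMeasurable_weightL {α : Type*} [TopologicalSpace α] [MeasurableSpace α]
    [OpensMeasurableSpace α] {μ : Measure α} {ρ : α → ι → ℝ}
    (hρ : Continuous ρ) {e : α → PiLp 2 V} (he : AEStronglyMeasurable e μ) :
    AEStronglyMeasurable (fun t => weightL 𝕜 V (ρ t) (e t)) μ := by
  have hc : Continuous fun q : (ι → ℝ) × PiLp 2 V => weightL 𝕜 V q.1 q.2 := by
    refine (PiLp.continuous_toLp 2 V).comp (continuous_pi fun i => ?_)
    exact (RCLike.continuous_ofReal.comp ((continuous_apply i).comp continuous_fst)).smul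
      ((PiLp.continuous_apply 2 V i).comp continuous_snd)
  have hm : AEStronglyMeasurable (fun t => (ρ t, e t)) μ := hρ.aestronglyMeasurable.prodMk he
  have h := Continuous.comp_aestronglyMeasurable
    (g := fun q : (ι → ℝ) × PiLp 2 V => weightL 𝕜 V q.1 q.2) hc hm
  exact h

/-- The weights `√(1 + i √t)`. -/
noncomputable def switchingWeight (n : ℕ) (t : ℝ) (i : Fin n) : ℝ := √(1 + (i : ℝ) * √t)

theorem one_le_switchingWeight {n : ℕ} (t : ℝ) (i : Fin n) : 1 ≤ switchingWeight n t i :=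
  Real.one_le_sqrt.2 (by
    have := Real.sqrt_nonneg t
    nlinarith [(Nat.cast_nonneg i.1 : (0 : ℝ) ≤ _)])

theorem continuous_switchingWeight (n : ℕ) : Continuous (switchingWeight n) := by
  unfold switchingWeight
  fun_prop

theorem continuous_inv_switchingWeight (n : ℕ) :
    Continuous fun t i => (switchingWeight n t i)⁻¹ :=
  continuous_pi fun i => ((continuous_apply i).comp (continuous_switchingWeight n)).inv₀
    fun t => (zero_lt_one.trans_le (one_le_switchingWeight t i)).ne'

theorem switchingWeight_le {n : ℕ} {t T : ℝ} (ht : t ≤ T) (i : Fin n) :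
    switchingWeight n t i ≤ √(1 + n * √T) := by
  unfold switchingWeight
  gcongr
  exact i.2.le

end Weight

section Control

variable {𝕜 : Type*} [RCLike 𝕜] {H : Type*} [NormedAddCommGroup H] [InnerProductSpace 𝕜 H]
  [CompleteSpace H] {A : H →ₗ.[𝕜] H}

theorem AdjointFlow.continuousOn_sub (F : AdjointFlow A) (τ : ℝ) (φ : AdjDomain A) :
    ContinuousOn (fun t => F.S (τ - t) φ) (Icc 0 τ) :=
  (F.continuousOn φ).comp (by fun_prop) fun _ ht => sub_nonneg.2 ht.2

/-- The observation of the adjoint flow on `(0, τ)`, with weights, as an operator into `L²`. -/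
theorem AdjointFlow.exists_weighted_observation (F : AdjointFlow A) {ι : Type*} [Fintype ι]
    {V : ι → Type*} [∀ i, NormedAddCommGroup (V i)] [∀ i, InnerProductSpace 𝕜 (V i)]
    (L : AdjDomain A →L[𝕜] PiLp 2 V) {ρ : ℝ → ι → ℝ} (hρ : Continuous ρ) {R : ℝ} (hR : 0 ≤ R)
    (τ : ℝ) (hρR : ∀ t ∈ Ioo 0 τ, ∀ i, |ρ t i| ≤ R) :
    ∃ Ψ : AdjDomain A →L[𝕜] Lp (PiLp 2 V) 2 (volume.restrict (Ioo 0 τ)),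
      ∀ φ, ∀ᵐ t ∂volume.restrict (Ioo 0 τ), Ψ φ t = weightL 𝕜 V (ρ t) (L (F.S (τ - t) φ)) := by
  obtain ⟨M, hM⟩ := F.exists_bound τ
  refine exists_clm_Lp (fun t => weightL 𝕜 V (ρ t) ∘L L ∘L F.S (τ - t)) (fun φ => ?_)
    (M := R * (‖L‖ * M)) ?_
  · have h : ContinuousOn (fun t => L (F.S (τ - t) φ)) (Ioo 0 τ) :=
      L.continuous.comp_continuousOn ((F.continuousOn_sub τ φ).mono Ioo_subset_Icc_self)
    exact aestronglyMeasurable_weightL hρ (h.aestronglyMeasurable measurableSet_Ioo)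
  · filter_upwards [ae_restrict_mem measurableSet_Ioo] with t ht
    have hMt := hM (τ - t) ⟨by linarith [ht.2], by linarith [ht.1]⟩
    have hM0 : 0 ≤ M := (norm_nonneg (F.S (τ - t))).trans hMt
    refine ContinuousLinearMap.opNorm_le_bound _ (by positivity) fun φ => ?_
    refine (norm_weightL_apply_le hR (hρR t ht) _).trans ?_
    rw [mul_assoc, mul_assoc]
    gcongr
    exact (L.le_opNorm _).trans (by gcongr; exact (F.S (τ - t)).le_of_opNorm_le hMt φ)

theorem AdjointFlow.exists_observation (F : AdjointFlow A) {E : Type*} [NormedAddCommGroup E]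
    [InnerProductSpace 𝕜 E] (L : AdjDomain A →L[𝕜] E) (τ : ℝ) :
    ∃ Ψ : AdjDomain A →L[𝕜] Lp E 2 (volume.restrict (Ioo 0 τ)),
      ∀ φ, ∀ᵐ t ∂volume.restrict (Ioo 0 τ), Ψ φ t = L (F.S (τ - t) φ) := by
  obtain ⟨M, hM⟩ := F.exists_bound τ
  refine exists_clm_Lp (fun t => L ∘L F.S (τ - t)) (fun φ => ?_) (M := ‖L‖ * M) ?_
  · have h : ContinuousOn (fun t => L (F.S (τ - t) φ)) (Ioo 0 τ) :=
      L.continuous.comp_continuousOn ((F.continuousOn_sub τ φ).mono Ioo_subset_Icc_self)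
    exact h.aestronglyMeasurable measurableSet_Ioo
  · filter_upwards [ae_restrict_mem measurableSet_Ioo] with t ht
    have hMt := hM (τ - t) ⟨by linarith [ht.2], by linarith [ht.1]⟩
    refine (ContinuousLinearMap.opNorm_comp_le _ _).trans ?_
    gcongr

theorem AdjointFlow.norm_sq_observation (F : AdjointFlow A) {E : Type*} [NormedAddCommGroup E]
    [InnerProductSpace 𝕜 E] (L : AdjDomain A →L[𝕜] E) {τ : ℝ} (hτ : 0 ≤ τ) (φ : AdjDomain A)
    {f : Lp E 2 (volume.restrict (Ioo 0 τ))}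
    (hf : ∀ᵐ t ∂volume.restrict (Ioo 0 τ), f t = L (F.S (τ - t) φ)) :
    ‖f‖ ^ 2 = ∫ r in (0 : ℝ)..τ, ‖L (F.S r φ)‖ ^ 2 := by
  have h1 : ∫ r in (0 : ℝ)..τ, ‖L (F.S r φ)‖ ^ 2 =
      ∫ t in (0 : ℝ)..τ, ‖L (F.S (τ - t) φ)‖ ^ 2 := by
    rw [intervalIntegral.integral_comp_sub_left (fun r => ‖L (F.S r φ)‖ ^ 2), sub_self, sub_zero]
  rw [h1, norm_sq_eq_integral_norm_sq, intervalIntegral.integral_of_le hτ,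
    integral_Ioc_eq_integral_Ioo]
  refine integral_congr_ae ?_
  filter_upwards [hf] with t ht
  rw [ht]

theorem AdjointFlow.integral_mono (F : AdjointFlow A) {E : Type*} [NormedAddCommGroup E]
    [InnerProductSpace 𝕜 E] (L : AdjDomain A →L[𝕜] E) {s τ : ℝ} (hs : 0 ≤ s) (hsτ : s ≤ τ)
    (φ : AdjDomain A) :
    ∫ r in (0 : ℝ)..s, ‖L (F.S r φ)‖ ^ 2 ≤ ∫ r in (0 : ℝ)..τ, ‖L (F.S r φ)‖ ^ 2 := by
  refine intervalIntegral.integral_mono_interval le_rfl hs hsτ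
    (Eventually.of_forall fun t => sq_nonneg _) (ContinuousOn.intervalIntegrable ?_)
  rw [uIcc_of_le (hs.trans hsτ)]
  exact ((L.continuous.comp_continuousOn (F.continuousOn φ)).norm.pow 2).mono Icc_subset_Ici_self

/-- Null-controllability in terms of the adjoint flow. -/
theorem AdjointFlow.exists_control (F : AdjointFlow A) {E U : Type*} [NormedAddCommGroup E]
    [InnerProductSpace 𝕜 E] [CompleteSpace E] [NormedAddCommGroup U] [InnerProductSpace 𝕜 U]
    {B : U →L[𝕜] AdjDual A} (hB : IsNullControllable A B) (e : U →L[𝕜] E)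
    (L : AdjDomain A →L[𝕜] E) (hL : ∀ φ u, inner 𝕜 (L φ) (e u) = B u φ) {T : ℝ} (hT : 0 < T) :
    ∃ C : ℝ, 0 ≤ C ∧ ∀ y₀ : H, ∃ u : Lp E 2 (volume.restrict (Ioo 0 T)), ‖u‖ ≤ C * ‖y₀‖ ∧
      ∀ φ, ∀ f : Lp E 2 (volume.restrict (Ioo 0 T)),
        (∀ᵐ t ∂volume.restrict (Ioo 0 T), f t = L (F.S (T - t) φ)) →
        inner 𝕜 (F.S T φ : H × H).1 y₀ + inner 𝕜 f u = 0 := by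
  obtain ⟨C, hC⟩ := hB T hT
  refine ⟨‖e‖ * C, by positivity, fun y₀ => ?_⟩
  obtain ⟨u, y, hu, hy, hyT, hun⟩ := hC y₀
  have heu : MemLp (fun t => e (u t)) 2 (volume.restrict (Ioo 0 T)) := e.comp_memLp' hu
  refine ⟨heu.toLp _, ?_, fun φ f hf => ?_⟩
  · have h1 : (heu.toLp _ : Lp E 2 (volume.restrict (Ioo 0 T))) = e.compLp (hu.toLp u) := by
      refine Lp.ext ?_
      filter_upwards [heu.coeFn_toLp, e.coeFn_compLp (hu.toLp u), hu.coeFn_toLp] with t h1 h2 h3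
      rw [h1, h2, h3]
    have h2 : ‖hu.toLp u‖ ≤ C * ‖y₀‖ := by
      rw [Lp.norm_toLp]
      refine (ENNReal.toReal_mono (by finiteness) hun).trans ?_
      simp
    rw [h1, mul_assoc]
    exact (e.norm_compLp_le _).trans (by gcongr)
  · have h1 := hy T (right_mem_Icc.2 hT.le) _ (F.isAdjointSolution T φ)
    rw [hyT] at h1
    simp only [sub_zero, sub_self] at h1
    rw [_root_.zero_apply, intervalIntegral.integral_of_le hT.le,
      integral_Ioc_eq_integral_Ioo] at h1
    rw [h1, L2.inner_def]
    congr 1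
    refine integral_congr_ae ?_
    filter_upwards [hf, heu.coeFn_toLp] with t h2 h3
    rw [h2, h3, hL]

/-- Observability of the adjoint flow. -/
theorem AdjointFlow.exists_observability (F : AdjointFlow A) {E U : Type*} [NormedAddCommGroup E]
    [InnerProductSpace 𝕜 E] [CompleteSpace E] [NormedAddCommGroup U] [InnerProductSpace 𝕜 U]
    {B : U →L[𝕜] AdjDual A} (hB : IsNullControllable A B) (e : U →L[𝕜] E)
    (L : AdjDomain A →L[𝕜] E) (hL : ∀ φ u, inner 𝕜 (L φ) (e u) = B u φ) {T : ℝ} (hT : 0 < T) :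
    ∃ C : ℝ, 0 ≤ C ∧ ∀ φ, ‖(F.S T φ : H × H).1‖ ≤
      C * √(∫ r in (0 : ℝ)..T, ‖L (F.S r φ)‖ ^ 2) := by
  obtain ⟨C, hC0, hC⟩ := F.exists_control hB e L hL hT
  obtain ⟨Ψ, hΨ⟩ := F.exists_observation L T
  refine ⟨C, hC0, fun φ => ?_⟩
  rw [← F.norm_sq_observation L hT.le φ (hΨ φ), Real.sqrt_sq (norm_nonneg _)]
  set x := (F.S T φ : H × H).1 with hx
  obtain ⟨u, hu, hu'⟩ := hC x
  have h1 := eq_neg_of_add_eq_zero_left (hu' φ _ (hΨ φ))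
  have h2 : ‖x‖ * ‖x‖ ≤ C * ‖Ψ φ‖ * ‖x‖ := by
    calc ‖x‖ * ‖x‖ = ‖inner 𝕜 x x‖ := by
          rw [inner_self_eq_norm_sq_to_K, ← RCLike.ofReal_pow, RCLike.norm_ofReal,
            abs_of_nonneg (sq_nonneg _), sq]
      _ = ‖inner 𝕜 (Ψ φ) u‖ := by rw [h1, norm_neg]
      _ ≤ ‖Ψ φ‖ * ‖u‖ := norm_inner_le_norm _ _
      _ ≤ ‖Ψ φ‖ * (C * ‖x‖) := by gcongr
      _ = _ := by ring
  rcases (norm_nonneg x).eq_or_lt with h0 | h0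
  · rw [← h0]
    positivity
  · exact le_of_mul_le_mul_right h2 h0

end Control

section Closure

variable {𝕜 : Type*} [RCLike 𝕜] {H : Type*} [NormedAddCommGroup H] [InnerProductSpace 𝕜 H]
  [CompleteSpace H] {A : H →ₗ.[𝕜] H}

/-- Away from the final time, limits of weighted observations are weighted observations
of trajectories of the adjoint flow. -/
theorem AdjointFlow.exists_eq_observation_of_mem_closure (F : AdjointFlow A) {ι : Type*}
    [Fintype ι] {V : ι → Type*} [∀ i, NormedAddCommGroup (V i)] [∀ i, InnerProductSpace 𝕜 (V i)]
    {L : AdjDomain A →L[𝕜] PiLp 2 V} {ρ : ℝ → ι → ℝ} (hρ : ∀ t i, 1 ≤ ρ t i) {T : ℝ}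
    {Ψ : AdjDomain A →L[𝕜] Lp (PiLp 2 V) 2 (volume.restrict (Ioo 0 T))}
    (hΨ : ∀ φ, ∀ᵐ t ∂volume.restrict (Ioo 0 T), Ψ φ t = weightL 𝕜 V (ρ t) (L (F.S (T - t) φ)))
    {s : ℝ} (hs : 0 < s) (hsT : s ≤ T)
    (hobs : ∃ C : ℝ, 0 ≤ C ∧ ∀ φ, ‖(F.S s φ : H × H).1‖ ≤
      C * √(∫ r in (0 : ℝ)..s, ‖L (F.S r φ)‖ ^ 2))
    {p : Lp (PiLp 2 V) 2 (volume.restrict (Ioo 0 T))} (hp : p ∈ closure (range Ψ)) :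
    ∃ ζ : H, ∀ᵐ t ∂volume.restrict (Ioo 0 T), t < T - s →
      p t = weightL 𝕜 V (ρ t) (L (F.Γ (F.K (T - s - t) ζ))) := by
  obtain ⟨C, hC0, hC⟩ := hobs
  obtain ⟨Ψ₀, hΨ₀⟩ := F.exists_observation L T
  have hbound : ∀ φ, ‖(F.S s φ : H × H).1‖ ≤ C * ‖Ψ φ‖ := fun φ => by
    refine (hC φ).trans (mul_le_mul_of_nonneg_left ?_ hC0)
    have h1 := F.integral_mono L hs.le hsT φ
    rw [← F.norm_sq_observation L (hs.le.trans hsT) φ (hΨ₀ φ)] at h1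
    refine (Real.sqrt_le_sqrt h1).trans ?_
    rw [Real.sqrt_sq (norm_nonneg _)]
    refine Lp.norm_le_norm_of_ae_le ?_
    filter_upwards [hΨ φ, hΨ₀ φ] with t h2 h3
    rw [h2, h3]
    exact norm_le_norm_weightL_apply (hρ t) _
  obtain ⟨q, hq, hqp⟩ := mem_closure_iff_seq_limit.1 hp
  choose φ hφ using hq
  have hφp : Tendsto (fun k => Ψ (φ k)) atTop (𝓝 p) := by simpa only [hφ] using hqp
  have hcau : CauchySeq fun k => (F.S s (φ k) : H × H).1 := by
    refine Metric.cauchySeq_iff.2 fun ε hε => ?_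
    obtain ⟨N, hN⟩ := Metric.cauchySeq_iff.1 hφp.cauchySeq (ε / (C + 1)) (by positivity)
    refine ⟨N, fun m hm n hn => ?_⟩
    have h1 := hN m hm n hn
    rw [dist_eq_norm, ← map_sub] at h1
    have h2 := hbound (φ m - φ n)
    rw [map_sub, Submodule.coe_sub, Prod.fst_sub, ← dist_eq_norm] at h2
    rw [lt_div_iff₀ (by positivity)] at h1
    refine h2.trans_lt ?_
    nlinarith [norm_nonneg (Ψ (φ m - φ n))]
  obtain ⟨ζ, hζ⟩ := cauchySeq_tendsto_of_complete hcau
  refine ⟨ζ, ?_⟩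
  obtain ⟨ns, hns, hae⟩ := (tendstoInMeasure_of_tendsto_Lp hφp).exists_seq_tendsto_ae
  have hall : ∀ᵐ t ∂volume.restrict (Ioo 0 T), ∀ k,
      Ψ (φ k) t = weightL 𝕜 V (ρ t) (L (F.S (T - t) (φ k))) := ae_all_iff.2 fun k => hΨ (φ k)
  filter_upwards [hae, hall] with t h1 h2 ht
  refine tendsto_nhds_unique h1 ?_
  have h3 : Tendsto (fun k => weightL 𝕜 V (ρ t) (L (F.Γ (F.K (T - s - t)
      (F.S s (φ k) : H × H).1)))) atTop
      (𝓝 (weightL 𝕜 V (ρ t) (L (F.Γ (F.K (T - s - t) ζ))))) :=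
    ((weightL 𝕜 V (ρ t) ∘L L ∘L F.Γ ∘L F.K (T - s - t)).continuous.tendsto ζ).comp hζ
  refine (h3.comp hns.tendsto_atTop).congr fun k => ?_
  rw [Function.comp_apply, h2, ← F.S_add _ _ _ (by linarith) hs.le]
  congr 4
  ring

theorem AdjointFlow.analyticOnNhd_norm_sq (F : AdjointFlow A) {W : Type*} [NormedAddCommGroup W]
    [InnerProductSpace 𝕜 W] (L : AdjDomain A →L[𝕜] W) (b : ℝ) (ζ : H) :
    AnalyticOnNhd ℝ (fun t => ‖L (F.Γ (F.K (b - t) ζ))‖ ^ 2) (Iio b) := by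
  let _ : NormedSpace ℝ H := NormedSpace.restrictScalars ℝ 𝕜 H
  let _ : NormedSpace ℝ W := NormedSpace.restrictScalars ℝ 𝕜 W
  have : IsScalarTower ℝ 𝕜 H := RestrictScalars.isScalarTower ℝ 𝕜 H
  have : IsScalarTower ℝ 𝕜 W := RestrictScalars.isScalarTower ℝ 𝕜 W
  refine SwitchingControl.analyticOnNhd_norm_sq (𝕜 := 𝕜) fun t ht => ?_
  have h1 : AnalyticAt ℝ (fun s => F.K s ζ) (b - t) := F.analytic ζ _ (mem_Ioi.2 (sub_pos.2 ht))
  have h2 : AnalyticAt ℝ (fun r => F.K (b - r) ζ) t :=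
    AnalyticAt.fun_comp (f := fun r : ℝ => b - r) h1 (by fun_prop)
  exact (((L ∘L F.Γ).restrictScalars ℝ).analyticAt _).comp h2

/-- The components of a limit of observations, weighted by `√(1 + i √t)`, only have the same norm
where they vanish. -/
theorem AdjointFlow.no_ties (F : AdjointFlow A) {n : ℕ}
    {V : Fin n → Type*} [∀ i, NormedAddCommGroup (V i)] [∀ i, InnerProductSpace 𝕜 (V i)]
    {L : AdjDomain A →L[𝕜] PiLp 2 V} {T : ℝ} (hT : 0 < T)
    {p : Lp (PiLp 2 V) 2 (volume.restrict (Ioo 0 T))}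
    (hp : ∀ s, 0 < s → s ≤ T → ∃ ζ : H, ∀ᵐ t ∂volume.restrict (Ioo 0 T), t < T - s →
      p t = weightL 𝕜 V (switchingWeight n t) (L (F.Γ (F.K (T - s - t) ζ))))
    {i j : Fin n} (hij : i ≠ j) :
    ∀ᵐ t ∂volume.restrict (Ioo 0 T), ‖p t i‖ = ‖p t j‖ → p t i = 0 := by
  have key : ∀ s, 0 < s → s < T → ∀ᵐ t ∂volume.restrict (Ioo 0 T), t < T - s →
      ‖p t i‖ = ‖p t j‖ → p t i = 0 := fun s hs hsT => by
    obtain ⟨ζ, hζ⟩ := hp s hs hsT.le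
    have htie := ae_eq_zero_of_sqrt_weight_mul_eq (sub_pos.2 hsT)
      (F.analyticOnNhd_norm_sq (PiLp.proj 2 V i ∘L L) (T - s) ζ)
      (F.analyticOnNhd_norm_sq (PiLp.proj 2 V j ∘L L) (T - s) ζ)
      (a := (i : ℝ)) (c := (j : ℝ)) (by exact_mod_cast fun h => hij (Fin.ext h))
    rw [ae_restrict_iff' measurableSet_Ioo] at htie
    filter_upwards [hζ, ae_restrict_of_ae htie, ae_restrict_mem measurableSet_Ioo]
      with t h1 h2 ht hts heq
    have hpk : ∀ k, p t k = (switchingWeight n t k : 𝕜) •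
        (PiLp.proj 2 V k ∘L L) (F.Γ (F.K (T - s - t) ζ)) := fun k => by
      rw [h1 hts, weightL_apply]
      rfl
    have hsq : ∀ k, ‖p t k‖ ^ 2 = (1 + (k : ℝ) * √t) *
        ‖(PiLp.proj 2 V k ∘L L) (F.Γ (F.K (T - s - t) ζ))‖ ^ 2 := fun k => by
      rw [hpk, norm_smul, RCLike.norm_ofReal, mul_pow, sq_abs, switchingWeight,
        Real.sq_sqrt (by positivity)]
    have h3 := h2 ⟨ht.1, hts⟩ (by rw [← hsq, ← hsq, heq])
    have h4 : ‖p t i‖ ^ 2 = 0 := by rw [hsq, h3, mul_zero]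
    exact norm_eq_zero.1 (pow_eq_zero_iff two_ne_zero |>.1 h4)
  have hall : ∀ᵐ t ∂volume.restrict (Ioo 0 T), ∀ m : ℕ, t < T - T / (m + 2) →
      ‖p t i‖ = ‖p t j‖ → p t i = 0 := ae_all_iff.2 fun m =>
    key _ (by positivity) (div_lt_self hT (by have := (Nat.cast_nonneg m : (0 : ℝ) ≤ m); linarith))
  filter_upwards [hall, ae_restrict_mem measurableSet_Ioo] with t h ht
  obtain ⟨m, hm⟩ := exists_nat_gt (T / (T - t))
  refine h m ?_
  have h1 : 0 < T - t := sub_pos.2 ht.2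
  rw [div_lt_iff₀ h1] at hm
  have h2 : T / (m + 2) < T - t := by
    rw [div_lt_iff₀ (by positivity)]
    nlinarith
  linarith

end Closure

section Main

variable {𝕜 : Type*} [RCLike 𝕜] {H : Type*} [NormedAddCommGroup H] [InnerProductSpace 𝕜 H]
  [CompleteSpace H] {A : H →ₗ.[𝕜] H}

/-- A control in `L²` gives rise to a solution by transposition. -/
theorem AdjointFlow.exists_solution (F : AdjointFlow A) {E : Type*} [NormedAddCommGroup E]
    [InnerProductSpace 𝕜 E] (L : AdjDomain A →L[𝕜] E) {T : ℝ} (y₀ : H) {u : ℝ → E}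
    (hu : MemLp u 2 (volume.restrict (Ioo 0 T))) {f : ℝ → AdjDual A}
    (hf : ∀ t φ, f t φ = inner 𝕜 (L φ) (u t)) (hT : 0 ≤ T)
    (hnull : ∀ φ, inner 𝕜 (F.S T φ : H × H).1 y₀ +
      ∫ t in Ioo 0 T, inner 𝕜 (L (F.S (T - t) φ)) (u t) = 0) :
    ∃ y, IsSolution A T y₀ f y ∧ y T = 0 := by
  have hex : ∀ τ, ∃ y : AdjDual A, τ ∈ Icc 0 T → ∀ φ,
      y φ = inner 𝕜 (F.S τ φ : H × H).1 y₀ +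
        ∫ t in Ioo 0 τ, inner 𝕜 (L (F.S (τ - t) φ)) (u t) := fun τ => by
    by_cases hτ : τ ∈ Icc 0 T
    · obtain ⟨Ψ, hΨ⟩ := F.exists_observation L τ
      have huτ : MemLp u 2 (volume.restrict (Ioo 0 τ)) :=
        hu.mono_measure (Measure.restrict_mono (Ioo_subset_Ioo_right hτ.2) le_rfl)
      refine ⟨((innerSL 𝕜).flip y₀ : H →L⋆[𝕜] 𝕜).comp (ContinuousLinearMap.fst 𝕜 H H ∘L
          A.adjoint.graph.subtypeL ∘L F.S τ) +
        ((innerSL 𝕜).flip (huτ.toLp u) : _ →L⋆[𝕜] 𝕜).comp Ψ, fun _ φ => ?_⟩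
      have h : inner 𝕜 (Ψ φ) (huτ.toLp u) =
          ∫ t in Ioo 0 τ, inner 𝕜 (L (F.S (τ - t) φ)) (u t) := by
        rw [L2.inner_def]
        refine integral_congr_ae ?_
        filter_upwards [hΨ φ, huτ.coeFn_toLp] with t h1 h2
        rw [h1, h2]
      rw [← h]
      rfl
    · exact ⟨0, fun h => absurd h hτ⟩
  choose y hy using hex
  refine ⟨y, fun τ hτ z hz => ?_, ?_⟩
  · rw [hy τ hτ, intervalIntegral.integral_of_le hτ.1, integral_Ioc_eq_integral_Ioo,
      F.eq_of_isAdjointSolution τ z hz 0 (left_mem_Icc.2 hτ.1), sub_zero]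
    congr 1
    refine setIntegral_congr_fun measurableSet_Ioo fun t ht => ?_
    rw [hf, F.eq_of_isAdjointSolution τ z hz t (Ioo_subset_Icc_self ht)]
  · ext φ
    rw [hy T (right_mem_Icc.2 hT), hnull]
    rfl

theorem AdjointFlow.isNullControllableSwitching (F : AdjointFlow A)
    {U : Type*} [NormedAddCommGroup U] [InnerProductSpace 𝕜 U] {B : U →L[𝕜] AdjDual A}
    {n : ℕ} [NeZero n] {V : Fin n → Type*} [∀ i, NormedAddCommGroup (V i)]
    [∀ i, InnerProductSpace 𝕜 (V i)] [∀ i, CompleteSpace (V i)] (π : (∀ i, V i) ≃L[𝕜] U)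
    (Bc : ∀ i, V i →L[𝕜] AdjDual A) (hBc : ∀ v : ∀ i, V i, B (π v) = ∑ i, Bc i (v i))
    (hNull : IsNullControllable A B) : IsNullControllableSwitching A Bc := by
  obtain ⟨L, hL⟩ := exists_control_adjoint (𝕜 := 𝕜) (D := AdjDomain A) (W := PiLp 2 V)
    (∑ i, Bc i ∘L PiLp.proj 2 V i)
  have hL' : ∀ φ (e : PiLp 2 V), inner 𝕜 (L φ) e = (∑ i, Bc i (e i)) φ := fun φ e => by
    rw [hL, _root_.sum_apply]
    rfl
  set κ : U →L[𝕜] PiLp 2 V := ((PiLp.continuousLinearEquiv 2 𝕜 V).symm : (∀ i, V i) →L[𝕜] PiLp 2 V)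
    ∘L (π.symm : U →L[𝕜] ∀ i, V i)
  have hLκ : ∀ φ u, inner 𝕜 (L φ) (κ u) = B u φ := fun φ u => by
    rw [hL']
    conv_rhs => rw [← π.apply_symm_apply u, hBc]
    rfl
  intro T hT
  set μ := volume.restrict (Ioo 0 T)
  set R : ℝ := √(1 + n * √T) with hR
  have hR0 : 0 ≤ R := Real.sqrt_nonneg _
  set ρ := switchingWeight n with hρ
  have hρ1 : ∀ t i, 1 ≤ ρ t i := one_le_switchingWeight
  have hρR : ∀ t ∈ Ioo 0 T, ∀ i, |ρ t i| ≤ R := fun t ht i => by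
    rw [abs_of_nonneg (zero_le_one.trans (hρ1 t i))]
    exact switchingWeight_le ht.2.le i
  have hρi : ∀ t i, |(ρ t i)⁻¹| ≤ 1 := fun t i => by
    rw [abs_of_nonneg (inv_nonneg.2 (zero_le_one.trans (hρ1 t i)))]
    exact inv_le_one_of_one_le₀ (hρ1 t i)
  obtain ⟨C, hC0, hC⟩ := F.exists_control hNull κ L hLκ hT
  obtain ⟨Ψ, hΨ⟩ := F.exists_weighted_observation L (continuous_switchingWeight n) hR0 T hρR
  obtain ⟨Ψ₀, hΨ₀⟩ := F.exists_observation L T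
  set X : Submodule 𝕜 (Lp (PiLp 2 V) 2 μ) :=
    (LinearMap.range (Ψ : AdjDomain A →ₗ[𝕜] Lp (PiLp 2 V) 2 μ)).topologicalClosure with hX
  have hXc : IsClosed (X : Set (Lp (PiLp 2 V) 2 μ)) := Submodule.isClosed_topologicalClosure _
  have hXties : ∀ p ∈ X, ∀ i j, i ≠ j → ∀ᵐ t ∂μ, ‖p t i‖ = ‖p t j‖ → p t i = 0 :=
    fun p hp i j hij => F.no_ties hT (fun s hs hsT =>
      F.exists_eq_observation_of_mem_closure hρ1 hΨ hs hsT
        (F.exists_observability hNull κ L hLκ hs) hp) hij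
  set c : ℝ := R * (2 * √(Fintype.card (Fin n)) * (1 * C)) with hc
  have hc0 : 0 ≤ c := by positivity
  refine ⟨c.toNNReal, fun y₀ => ?_⟩
  obtain ⟨u₀, hu₀n, hu₀⟩ := hC y₀
  have hu₀w : ∀ᵐ t ∂μ, ‖weightL 𝕜 V (fun i => (ρ t i)⁻¹) (u₀ t)‖ ≤ 1 * ‖u₀ t‖ :=
    Eventually.of_forall fun t => norm_weightL_apply_le zero_le_one (hρi t) _
  have hw₀ : MemLp (fun t => weightL 𝕜 V (fun i => (ρ t i)⁻¹) (u₀ t)) 2 μ :=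
    (Lp.memLp u₀).of_le_mul (aestronglyMeasurable_weightL (continuous_inv_switchingWeight n)
      (Lp.aestronglyMeasurable u₀)) hu₀w
  obtain ⟨w, hwX, hwn, hws⟩ := exists_switching_of_no_ties X hXc hXties (hw₀.toLp _)
  have hw₀n : ‖hw₀.toLp _‖ ≤ 1 * ‖u₀‖ := by
    refine Lp.norm_le_mul_norm_of_ae_le_mul ?_
    filter_upwards [hw₀.coeFn_toLp, hu₀w] with t h1 h2
    rwa [h1]
  set u : ℝ → PiLp 2 V := fun t => weightL 𝕜 V (ρ t) (w t) with hu
  have huw : ∀ᵐ t ∂μ, ‖u t‖ ≤ R * ‖w t‖ := by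
    filter_upwards [ae_restrict_mem measurableSet_Ioo] with t ht
    exact norm_weightL_apply_le hR0 (hρR t ht) _
  have hum : MemLp u 2 μ := (Lp.memLp w).of_le_mul
    (aestronglyMeasurable_weightL (continuous_switchingWeight n) (Lp.aestronglyMeasurable w)) huw
  have hnull : ∀ φ, inner 𝕜 (F.S T φ : H × H).1 y₀ +
      ∫ t in Ioo 0 T, inner 𝕜 (L (F.S (T - t) φ)) (u t) = 0 := fun φ => by
    rw [← hu₀ φ _ (hΨ₀ φ)]
    congr 1
    have h1 : ∫ t in Ioo 0 T, inner 𝕜 (L (F.S (T - t) φ)) (u t) = inner 𝕜 (Ψ φ) w := by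
      rw [L2.inner_def]
      refine integral_congr_ae ?_
      filter_upwards [hΨ φ] with t h
      rw [h, inner_weightL_left]
    have h2 : inner 𝕜 (Ψ φ) (hw₀.toLp _) = inner 𝕜 (Ψ₀ φ) u₀ := by
      rw [L2.inner_def, L2.inner_def]
      refine integral_congr_ae ?_
      filter_upwards [hΨ φ, hΨ₀ φ, hw₀.coeFn_toLp] with t h3 h4 h5
      rw [h3, h4, h5, inner_weightL_left,
        weightL_weightL_inv fun i => (zero_lt_one.trans_le (hρ1 t i)).ne']
    rw [h1, ← h2]
    exact hwX (Ψ φ) (Submodule.le_topologicalClosure _ ⟨φ, rfl⟩)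
  obtain ⟨y, hy, hyT⟩ := F.exists_solution (f := fun t => ∑ i, Bc i (u t i)) L y₀ hum
    (fun t φ => (hL' φ (u t)).symm) hT.le hnull
  refine ⟨fun i t => u t i, y, fun i => ?_, hy, hyT, fun i => ?_, ?_⟩
  · exact (PiLp.proj (𝕜 := 𝕜) 2 V i).comp_memLp' hum
  · have h1 : eLpNorm (fun t => u t i) 2 μ ≤ ENNReal.ofReal R * eLpNorm w 2 μ := by
      refine eLpNorm_le_mul_eLpNorm_of_ae_le_mul ?_ 2
      filter_upwards [huw] with t ht
      exact (PiLp.norm_apply_le _ i).trans ht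
    have h2 : ‖w‖ ≤ 2 * √(Fintype.card (Fin n)) * (1 * C) * ‖y₀‖ := by
      refine hwn.trans ?_
      rw [mul_assoc _ (1 * C), mul_assoc 1]
      gcongr
      exact hw₀n.trans (by gcongr)
    refine h1.trans ?_
    rw [← Lp.enorm_def, ← ofReal_norm, ← ENNReal.ofReal_mul hR0, ← ofReal_norm y₀]
    change _ ≤ ENNReal.ofReal c * _
    rw [← ENNReal.ofReal_mul hc0]
    refine ENNReal.ofReal_le_ofReal ?_
    rw [hc, mul_assoc R]
    gcongr
  · filter_upwards [hws] with t ht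
    obtain ⟨i, hi⟩ := ht
    refine Finset.prod_eq_zero (Finset.mem_univ i) (Finset.sum_eq_zero fun j hj => ?_)
    simp only [hu]
    rw [weightL_apply, hi j (Finset.ne_of_mem_erase hj), smul_zero, norm_zero]

end Main

end SwitchingControl

open SwitchingControl in
theorem theorem1p2 {𝕜 : Type*} [RCLike 𝕜]
    {H : Type*} [NormedAddCommGroup H] [InnerProductSpace 𝕜 H] [CompleteSpace H]
    (A : H →ₗ.[𝕜] H)
    (hA : (IsSelfAdjoint A ∧ IsPosDef A ∧ HasCompactResolvent A) ∨
      (FiniteDimensional 𝕜 H ∧ A.domain = ⊤))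
    {U : Type*} [NormedAddCommGroup U] [InnerProductSpace 𝕜 U] [CompleteSpace U]
    (B : U →L[𝕜] AdjDual A)
    (n : ℕ) (hn : 2 ≤ n)
    {V : Fin n → Type*} [∀ i, NormedAddCommGroup (V i)] [∀ i, InnerProductSpace 𝕜 (V i)]
    [∀ i, CompleteSpace (V i)]
    (π : (∀ i, V i) ≃L[𝕜] U)
    (Bc : ∀ i, V i →L[𝕜] AdjDual A)
    (hBc : ∀ v : ∀ i, V i, B (π v) = ∑ i, Bc i (v i))
    (hNull : IsNullControllable A B) :
    IsNullControllableSwitching A Bc := by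
  have : NeZero n := ⟨by omega⟩
  have hF : Nonempty (AdjointFlow A) := by
    rcases hA with ⟨h1, h2, h3⟩ | ⟨h1, h2⟩
    · exact nonempty_adjointFlow_of_isSelfAdjoint h1 h2 h3
    · exact nonempty_adjointFlow_of_finiteDimensional h2
  obtain ⟨F⟩ := hF
  exact F.isNullControllableSwitching π Bc hBc hNull
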